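/- Let $m\ge 0$ and let $\boldsymbol n=(n_1,\dots,n_m)$ be a tuple of nonnegative integers, $n=n_1+\cdots+n_m$. Split $[n]=\{1,\dots,n\}$ into the consecutive boxes $S_j=\{n_1+\cdots+n_{j-1}+1,\dots,n_1+\cdots+n_j\}$, and let $\mathcal D(\boldsymbol n)$ be the set of inhomogeneous derangements, i.e. the permutations $\sigma$ of $[n]$ with $\sigma(S_j)\cap S_j=\emptyset$ for all $j$. Put $\mathrm{exc}(\sigma)=\#\{i: i<\sigma(i)\}$, $$\mathrm{cr}(\sigma)=\sum_{i=1}^n\#\{j: j<i\le\sigma(j)<\sigma(i)\}+\sum_{i=1}^n\#\{j: j>i>\sigma(j)>\sigma(i)\},\qquad I(\boldsymbol n|q)=\sum_{\sigma\in\mathcal D(\boldsymbol n)}y^{\mathrm{exc}(\sigma)}q^{\mathrm{cr}(\sigma)} .$$ With $[k]_q=1+q+\cdots+q^{k-1}$, let the $q$-Laguerre polynomials $L_k(x|q)$ be defined by $L_{-1}=0$, $L_0=1$ and $$L_{k+1}(x|q)=(x-y[k+1]_q-[k]_q)L_k(x|q)-y[k]_q^2L_{k-1}(x|q)\qquad(k\ge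 0).$$ (a) Let $y,q$ be real with $-1<q<1$, $y\ge 1$ and $yq^2\le 1$. With $(q;q)_\infty=\prod_{k\ge 0}(1-q^{k+1})$, put $$u_2(x)=\frac{(1-q)^2}{2y}x^2-\frac{(1-q)(1+y)}{y}x+\frac{y^2+1}{2y},\qquad v_2(x)=\frac{(q-1)x+y+1}{2\sqrt y},\qquad B_\pm=\frac{(1\pm\sqrt y)^2}{1-q},$$ and, for a polynomial $f$, $$\mathcal L_2(f)=\frac{(q;q)_\infty^2}{2\pi}\,\frac{1-q}{2\sqrt y}\int_{B_-}^{B_+}\Bigg(\prod_{k=0}^\infty\frac{1-2u_2(x)q^k+q^{2k}}{[1-2v_2(x)q^k/\sqrt y+q^{2k}/y]\,[1-2v_2(x)q^{k+1}\sqrt y+q^{2k+2}y]}\Bigg)\frac{f(x)\,dx}{\sqrt{1-v_2(x)^2}} .$$ Then for $f=L_{n_1}(x|q)\cdots L_{n_m}(x|q)$ the integrand is integrable on $[B_-,B_+]$ and $$I(\boldsymbol n|q)=\mathcal L_2\big(L_{n_1}(x|q)\cdots L_{n_m}(x|q)\big).$$ (b) Let $y,q$ be arbitrary elements of a commutative ring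 $R$ (for instance, indeterminates), and let $\Lambda:R[x]\to R$ be an $R$-linear functional with $\Lambda(1)=1$ and $\Lambda(L_k(x|q)L_l(x|q))=0$ for all $k\ne l$. Then $$I(\boldsymbol n|q)=\Lambda\big(L_{n_1}(x|q)\cdots L_{n_m}(x|q)\big).$$ -/

import Mathlib

/-!
A permutation that sends no point into its own box is a placement of rooks in all rows of the
board of cells joining different boxes. Weight partial placements so that the full ones get
`y ^ exc * q ^ cr`. Adding a box of size `k` to the board, next to `h` free rows and `h` free
columns, multiplies the weighted sum by exactly the coefficients of the linearization
`L_k L_h = ∑ c_{r,s} L_{h+k-r-s}`. Hence `∏ j, L_{n_j}` is the sum, over all placements, of the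
weight times `L_d`, with `d` the number of free rows, and a linear functional with `Λ 1 = 1` that
kills `L_d` for all `d ≥ 1` retains the full placements, that is, `I(n | q)`.

For the integral, `x = (y + 1 - 2 √y cos θ) / (1 - q)` turns `L_k` into a multiple of the
Al-Salam–Chihara polynomial `Q_k(cos θ; a, b | q)`, and the density into its weight function, with
`a = 1 / √y` and `b = q √y`, so that `a b = q`. The total mass is found by expanding
`1 / (a e^{±iθ}; q)_∞` and `1 / (b e^{±iθ}; q)_∞` in continuous `q`-Hermite polynomials, whose
orthogonality is read off from the Fourier coefficients of the finite products
`(e^{2iθ}; q)_N (e^{-2iθ}; q)_N`; it depends on `a b` only. The boundary cases `|a| = 1` and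
`|b| = 1` are limits. Multiplying the weight by `|1 - a e^{iθ}| ^ 2` replaces `a` by `a q`, and
the resulting contiguity relation shows by induction that `Q_k` integrates to `0` for `k ≥ 1`.
-/

open Polynomial

namespace QLaguerre

/-! ### Combinatorics: boxes, inhomogeneous derangements, excedances, crossings -/

/-- The box `S_j`: the `j`-th of the consecutive intervals, of lengths `n 0, n 1, …`, that make up
the ground set `{0, …, N - 1}`, `N = ∑ i, n i`. -/
def box {m : ℕ} (n : Fin m → ℕ) (j : Fin m) : Finset (Fin (∑ i, n i)) :=
  Finset.univ.filter fun k =>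
    ∑ i ∈ Finset.Iio j, n i ≤ (k : ℕ) ∧ (k : ℕ) < ∑ i ∈ Finset.Iic j, n i

/-- The set `D(n)` of inhomogeneous derangements: permutations `σ` with `σ(S_j) ∩ S_j = ∅` for
every box `S_j`. -/
def inhomDerangements {m : ℕ} (n : Fin m → ℕ) : Finset (Equiv.Perm (Fin (∑ i, n i))) :=
  Finset.univ.filter fun σ => ∀ j, (box n j).image σ ∩ box n j = ∅

/-- Number of excedances of a permutation. -/
def exc {N : ℕ} (σ : Equiv.Perm (Fin N)) : ℕ :=
  (Finset.univ.filter fun i => i < σ i).card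

/-- Number of crossings of a permutation. -/
def cr {N : ℕ} (σ : Equiv.Perm (Fin N)) : ℕ :=
  ∑ i, (Finset.univ.filter fun j => j < i ∧ i ≤ σ j ∧ σ j < σ i).card +
    ∑ i, (Finset.univ.filter fun j => j > i ∧ i > σ j ∧ σ j > σ i).card

/-- The enumerative polynomial `I(n; y | q)` of inhomogeneous derangements. -/
def derangementSum {R : Type*} [CommRing R] (y q : R) {m : ℕ} (n : Fin m → ℕ) : R :=
  ∑ σ ∈ inhomDerangements n, y ^ exc σ * q ^ cr σ

/-! ### The `q`-Laguerre polynomials -/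

/-- The `q`-integer `[n]_q = 1 + q + ⋯ + q ^ (n - 1)`. -/
def qInt {R : Type*} [CommRing R] (q : R) (n : ℕ) : R :=
  ∑ i ∈ Finset.range n, q ^ i

/-- The `q`-Laguerre polynomials `L_n(x | q)`, given by their three-term recurrence
`L_{n+1} = (x - y [n+1]_q - [n]_q) L_n - y [n]_q ^ 2 L_{n-1}`, `L_{-1} = 0`, `L_0 = 1`. -/
noncomputable def qLaguerre {R : Type*} [CommRing R] (y q : R) : ℕ → R[X]
  | 0 => 1
  | 1 => X - C (y * qInt q 1 + qInt q 0)
  | n + 2 => (X - C (y * qInt q (n + 2) + qInt q (n + 1))) * qLaguerre y q (n + 1) -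
      C (y * qInt q (n + 1) ^ 2) * qLaguerre y q n

/-- A normalized linear functional with respect to which the `q`-Laguerre polynomials are
orthogonal. -/
def IsOrthogonalityFunctional {R : Type*} [CommRing R] (y q : R) (Λ : R[X] →ₗ[R] R) : Prop :=
  Λ 1 = 1 ∧ ∀ k l : ℕ, k ≠ l → Λ (qLaguerre y q k * qLaguerre y q l) = 0

/-! ### The explicit moment functional -/

/-- The infinite `q`-shifted factorial `(a; q)_∞`. -/
noncomputable def qPochInf (a q : ℝ) : ℝ :=
  ∏' k : ℕ, (1 - a * q ^ k)

noncomputable def u₂ (y q x : ℝ) : ℝ :=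
  (1 - q) ^ 2 / (2 * y) * x ^ 2 - (1 - q) * (1 + y) / y * x + (y ^ 2 + 1) / (2 * y)

noncomputable def v₂ (y q x : ℝ) : ℝ :=
  (q - 1) / (2 * √y) * x + (y + 1) / (2 * √y)

/-- The density, up to the constant factor, of the orthogonality measure. -/
noncomputable def weight (y q x : ℝ) : ℝ :=
  (∏' k : ℕ, (1 - 2 * u₂ y q x * q ^ k + q ^ (2 * k)) /
    ((1 - 2 * v₂ y q x * q ^ k / √y + q ^ (2 * k) / y) *
      (1 - 2 * v₂ y q x * q ^ (k + 1) * √y + q ^ (2 * k + 2) * y))) /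
    √(1 - v₂ y q x ^ 2)

/-- The left end point `B_-` of the support. -/
noncomputable def Bminus (y q : ℝ) : ℝ := (1 - √y) ^ 2 / (1 - q)

/-- The right end point `B_+` of the support. -/
noncomputable def Bplus (y q : ℝ) : ℝ := (1 + √y) ^ 2 / (1 - q)

/-- The moment functional `𝓛₂`, as an explicit integral over `[B_-, B_+]`. -/
noncomputable def momentFunctional (y q : ℝ) (f : ℝ[X]) : ℝ :=
  qPochInf q q * qPochInf q q / (2 * Real.pi) * ((1 - q) / (2 * √y)) *
    ∫ x in (Bminus y q)..(Bplus y q), weight y q x * f.eval x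

end QLaguerre

namespace QLaguerre

open Finset

/-! ### Triangular numbers and `q`-integers -/

/-- The triangular number `d (d + 1) / 2` of an arbitrary integer `d`. -/
def triangle (d : ℤ) : ℕ := (d * (d + 1) / 2).toNat

theorem two_mul_triangle (d : ℤ) : (2 * triangle d : ℤ) = d * (d + 1) := by
  have hnonneg : 0 ≤ d * (d + 1) := by
    rcases le_or_gt 0 d with h | h
    · positivity
    · exact mul_nonneg_of_nonpos_of_nonpos h.le (by omega)
  rw [triangle, Int.toNat_of_nonneg (by omega)]
  exact Int.mul_ediv_cancel' (Int.even_mul_succ_self d).two_dvd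

theorem triangle_add_one (d : ℤ) : (triangle (d + 1) : ℤ) = triangle d + (d + 1) := by
  linarith [two_mul_triangle d, two_mul_triangle (d + 1)]

theorem triangle_neg (d : ℤ) : triangle (-d) = triangle (d - 1) := by
  rw [triangle, triangle]
  ring_nf

@[simp] theorem triangle_zero : triangle 0 = 0 := rfl

section QInt

variable {R : Type*} [CommRing R] (q : R)

@[simp] theorem qInt_zero : qInt q 0 = 0 := by simp [qInt]

@[simp] theorem qInt_one : qInt q 1 = 1 := by simp [qInt]

theorem qInt_succ (n : ℕ) : qInt q (n + 1) = q * qInt q n + 1 := by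
  rw [qInt, sum_range_succ', qInt, mul_sum]
  simp only [pow_succ', pow_zero]

theorem qInt_add (m n : ℕ) : qInt q (m + n) = qInt q m + q ^ m * qInt q n := by
  simp only [qInt, sum_range_add, mul_sum, pow_add]

theorem map_qInt {S : Type*} [CommRing S] (f : R →+* S) (n : ℕ) :
    f (qInt q n) = qInt (f q) n := by
  simp only [qInt, map_sum, map_pow]

end QInt

/-! ### The coefficients of the linearization formula -/

section FallingBinomial

variable {R : Type*} [CommRing R] (q : R) (h : ℕ)

/-- The product `[h]_q [h-1]_q ⋯ [h-r+1]_q ⋅ (k choose r)_q` of a `q`-falling factorial and a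
Gaussian binomial coefficient, defined by a recurrence of Pascal type so that no division occurs:
it enumerates by a power of `q` the placements of `r` rooks on a board with `k` rows and `h`
columns. -/
def fallingBinomial : ℕ → ℕ → R
  | _, 0 => 1
  | 0, _ + 1 => 0
  | k + 1, r + 1 => fallingBinomial k (r + 1) + q ^ (k - r) * qInt q (h - r) * fallingBinomial k r

@[simp] theorem fallingBinomial_zero_right (k : ℕ) : fallingBinomial q h k 0 = 1 := by
  cases k <;> rw [fallingBinomial]

theorem fallingBinomial_succ_succ (k r : ℕ) : fallingBinomial q h (k + 1) (r + 1) =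
    fallingBinomial q h k (r + 1) + q ^ (k - r) * qInt q (h - r) * fallingBinomial q h k r := by
  rw [fallingBinomial]

theorem fallingBinomial_eq_zero_of_lt {k r : ℕ} (hkr : k < r) : fallingBinomial q h k r = 0 := by
  obtain ⟨r, rfl⟩ := Nat.exists_eq_succ_of_ne_zero (Nat.ne_zero_of_lt hkr)
  induction k generalizing r with
  | zero => rw [fallingBinomial]
  | succ k ih =>
    obtain ⟨r, rfl⟩ := Nat.exists_eq_succ_of_ne_zero (by omega : r ≠ 0)
    rw [Nat.succ_eq_add_one, fallingBinomial_succ_succ, ih _ (by omega), ih _ (by omega),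
      mul_zero, add_zero]

theorem fallingBinomial_eq_zero_of_lt_left {r : ℕ} (hhr : h < r) (k : ℕ) :
    fallingBinomial q h k r = 0 := by
  obtain ⟨r, rfl⟩ := Nat.exists_eq_succ_of_ne_zero (Nat.ne_zero_of_lt hhr)
  induction k with
  | zero => rw [fallingBinomial]
  | succ k ih =>
    rw [Nat.succ_eq_add_one] at ih ⊢
    obtain rfl | hlt := (Nat.lt_succ_iff.1 hhr).eq_or_lt
    · rw [fallingBinomial_succ_succ, ih, Nat.sub_self, qInt_zero]
      ring
    · rw [fallingBinomial_succ_succ, ih, Nat.sub_eq_zero_of_le hlt.le, qInt_zero]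
      ring

theorem qInt_mul_fallingBinomial_succ_right (k s : ℕ) :
    qInt q (s + 1) * fallingBinomial q h k (s + 1) =
      qInt q (h - s) * qInt q (k - s) * fallingBinomial q h k s := by
  induction k generalizing s with
  | zero => simp [fallingBinomial_eq_zero_of_lt]
  | succ k ih =>
    rcases lt_or_ge k s with hks | hsk
    · rw [fallingBinomial_eq_zero_of_lt q h (by omega : k + 1 < s + 1),
        Nat.sub_eq_zero_of_le hks, qInt_zero]
      ring
    · have hk : qInt q (k + 1) = qInt q (k - s) + q ^ (k - s) * qInt q (s + 1) := by
        rw [← qInt_add]; congr 1; omega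
      rw [fallingBinomial_succ_succ]
      cases s with
      | zero =>
        have ih_zero := ih 0
        rw [fallingBinomial_zero_right] at ih_zero
        rw [fallingBinomial_zero_right, fallingBinomial_zero_right, Nat.sub_zero (k + 1)]
        linear_combination ih_zero - qInt q (h - 0) * hk
      | succ s =>
        have hk' : qInt q (k + 1) = qInt q (k - s) + q ^ (k - s) * qInt q (s + 1) := by
          rw [← qInt_add]; congr 1; omega
        rw [fallingBinomial_succ_succ q h k s, Nat.add_sub_add_right]
        linear_combination ih (s + 1) + q ^ (k - s) * qInt q (h - (s + 1)) * ih s +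
          qInt q (h - (s + 1)) * fallingBinomial q h k (s + 1) * (hk' - hk)

theorem qInt_mul_fallingBinomial_succ_left (k s : ℕ) :
    qInt q (k + 1) * fallingBinomial q h k s =
      qInt q (k + 1 - s) * fallingBinomial q h (k + 1) s := by
  rcases lt_or_ge k s with hks | hsk
  · rw [fallingBinomial_eq_zero_of_lt q h hks, Nat.sub_eq_zero_of_le hks, qInt_zero]
    ring
  · cases s with
    | zero => simp
    | succ s =>
      have hk : qInt q (k + 1) = qInt q (k - s) + q ^ (k - s) * qInt q (s + 1) := by
        rw [← qInt_add]; congr 1; omega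
      rw [fallingBinomial_succ_succ, Nat.add_sub_add_right]
      linear_combination fallingBinomial q h k (s + 1) * hk +
        q ^ (k - s) * qInt_mul_fallingBinomial_succ_right q h k s

theorem sum_fallingBinomial_succ_mul (k : ℕ) (F : ℕ → R) :
    ∑ r ∈ range (k + 2), fallingBinomial q h (k + 1) r * F r =
      ∑ r ∈ range (k + 1),
        fallingBinomial q h k r * (F r + q ^ (k - r) * qInt q (h - r) * F (r + 1)) := by
  have hshift : ∑ r ∈ range (k + 1), fallingBinomial q h k (r + 1) * F (r + 1) + F 0 =
      ∑ r ∈ range (k + 1), fallingBinomial q h k r * F r := by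
    have := sum_range_succ' (fun r => fallingBinomial q h k r * F r) (k + 1)
    rw [sum_range_succ, fallingBinomial_eq_zero_of_lt q h k.lt_succ_self] at this
    simpa only [zero_mul, add_zero, fallingBinomial_zero_right, one_mul] using this.symm
  rw [sum_range_succ', fallingBinomial_zero_right, one_mul]
  simp only [fallingBinomial_succ_succ, mul_add, add_mul, sum_add_distrib, ← hshift]
  rw [add_right_comm]
  congr 1
  exact sum_congr rfl fun r _ => by ring

end FallingBinomial

theorem sum_range_succ_shift {A : Type*} [AddCommMonoid A] {k : ℕ} {F G : ℕ → A}
    (hF_zero : F 0 = 0) (hF_last : F (k + 1) = 0) (hFG : ∀ s ≤ k, F (s + 1) = G s) :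
    ∑ s ∈ range (k + 1), F s = ∑ s ∈ range (k + 1), G s := by
  have := sum_range_succ' F (k + 1)
  rw [sum_range_succ, hF_last, hF_zero, add_zero, add_zero] at this
  rw [this]
  exact sum_congr rfl fun s hs => hFG s (Nat.lt_succ_iff.1 (mem_range.1 hs))

section Linearization

variable {R : Type*} [CommRing R] (y q : R) (h k : ℕ)

/-- The coefficient of `L_{h+k-r-s}` in the linearization of `L_k L_h`. -/
def linearizationCoeff (r s : ℕ) : R :=
  y ^ r * q ^ triangle ((r : ℤ) - s) * fallingBinomial q h k r * fallingBinomial q h k s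

/-- The sum of `Φ r s` over all `r, s ≤ k`, weighted by the linearization coefficients. With
`Φ r s = L_{h+k-r-s}` it is the expansion of `L_k L_h`. -/
def linearizationSum (Φ : ℕ → ℕ → R) : R :=
  ∑ r ∈ range (k + 1), ∑ s ∈ range (k + 1), linearizationCoeff y q h k r s * Φ r s

variable {h k} in
theorem linearizationSum_congr {Φ Ψ : ℕ → ℕ → R}
    (hΦΨ : ∀ r s, r ≤ k → s ≤ k → r ≤ h → s ≤ h → Φ r s = Ψ r s) :
    linearizationSum y q h k Φ = linearizationSum y q h k Ψ := by
  refine sum_congr rfl fun r hr => sum_congr rfl fun s hs => ?_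
  rw [mem_range, Nat.lt_succ_iff] at hr hs
  rcases lt_or_ge h r with hr' | hr'
  · simp only [linearizationCoeff, fallingBinomial_eq_zero_of_lt_left q h hr', mul_zero, zero_mul]
  rcases lt_or_ge h s with hs' | hs'
  · simp only [linearizationCoeff, fallingBinomial_eq_zero_of_lt_left q h hs', mul_zero, zero_mul]
  rw [hΦΨ r s hr hs hr' hs']

theorem linearizationSum_add (Φ Ψ : ℕ → ℕ → R) :
    linearizationSum y q h k (fun r s => Φ r s + Ψ r s) =
      linearizationSum y q h k Φ + linearizationSum y q h k Ψ := by
  simp only [linearizationSum, mul_add, sum_add_distrib]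

theorem linearizationSum_const_mul (a : R) (Φ : ℕ → ℕ → R) :
    linearizationSum y q h k (fun r s => a * Φ r s) = a * linearizationSum y q h k Φ := by
  simp only [linearizationSum, mul_sum, mul_left_comm _ a]

@[simp] theorem linearizationSum_zero (Φ : ℕ → ℕ → R) : linearizationSum y q h 0 Φ = Φ 0 0 := by
  simp [linearizationSum, linearizationCoeff]

section PowTriangle

variable {k} {r s : ℕ}

theorem pow_triangle_succ_sub_mul (hr : r ≤ k) (hs : s ≤ k) :
    q ^ triangle (((r + 1 : ℕ) : ℤ) - s) * q ^ (k - r) =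
      q ^ triangle ((r : ℤ) - s) * q ^ (k + 1 - s) := by
  have := triangle_add_one ((r : ℤ) - s)
  rw [← pow_add, ← pow_add, show ((r + 1 : ℕ) : ℤ) - s = (r : ℤ) - s + 1 by push_cast; ring]
  congr 1
  omega

theorem pow_triangle_sub_succ_mul (hr : r ≤ k) (hs : s ≤ k) :
    q ^ triangle ((r : ℤ) - (s + 1 : ℕ)) * q ^ (k - s) =
      q ^ triangle ((r : ℤ) - s) * q ^ (k - r) := by
  have := triangle_add_one ((r : ℤ) - (s + 1 : ℕ))
  rw [show (r : ℤ) - (s + 1 : ℕ) + 1 = (r : ℤ) - s by push_cast; ring] at this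
  rw [← pow_add, ← pow_add]
  congr 1
  omega

end PowTriangle

theorem linearizationSum_succ (Φ : ℕ → ℕ → R) :
    linearizationSum y q h (k + 1) Φ = linearizationSum y q h k fun r s =>
      (Φ r s + y * q ^ (k + 1 - s) * qInt q (h - r) * Φ (r + 1) s) +
        q ^ (k - r) * qInt q (h - s) *
          (Φ r (s + 1) + y * q ^ (k - s) * qInt q (h - r) * Φ (r + 1) (s + 1)) := by
  have factor_out : ∀ k, linearizationSum y q h k Φ =
      ∑ r ∈ range (k + 1), fallingBinomial q h k r * ∑ s ∈ range (k + 1),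
        fallingBinomial q h k s * (y ^ r * q ^ triangle ((r : ℤ) - s) * Φ r s) := fun k => by
    simp only [linearizationSum, mul_sum]
    exact sum_congr rfl fun r _ => sum_congr rfl fun s _ => by rw [linearizationCoeff]; ring
  rw [factor_out (k + 1), sum_fallingBinomial_succ_mul]
  refine sum_congr rfl fun r hr => ?_
  rw [sum_fallingBinomial_succ_mul, sum_fallingBinomial_succ_mul, mul_sum, ← sum_add_distrib,
    mul_sum]
  refine sum_congr rfl fun s hs => ?_
  rw [mem_range, Nat.lt_succ_iff] at hr hs
  have htriangle : triangle (((r + 1 : ℕ) : ℤ) - (s + 1 : ℕ)) = triangle ((r : ℤ) - s) := by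
    congr 1; push_cast; ring
  rw [htriangle, linearizationCoeff, pow_succ y r]
  linear_combination (fallingBinomial q h k r * fallingBinomial q h k s * y ^ r) *
    (y * qInt q (h - r) * Φ (r + 1) s * pow_triangle_succ_sub_mul q hr hs +
      qInt q (h - s) * Φ r (s + 1) * pow_triangle_sub_succ_mul q hr hs)

section Recurrence

variable (ℓ : ℕ → R)

theorem linearizationSum_qInt_right :
    linearizationSum y q h k (fun r s => qInt q s * q ^ (k + 1 - s) * ℓ (h + k - r - s)) =
      linearizationSum y q h k fun r s =>
        q ^ (k - r) * qInt q (h - s) * qInt q (k - s) * ℓ (h + k - r - s - 1) := by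
  refine sum_congr rfl fun r hr =>
    sum_range_succ_shift (by simp only [qInt_zero]; ring) ?_ fun s hs => ?_
  · rw [linearizationCoeff, fallingBinomial_eq_zero_of_lt q h k.lt_succ_self]
    ring
  · rw [mem_range, Nat.lt_succ_iff] at hr
    simp only [linearizationCoeff, Nat.add_sub_add_right, ← Nat.sub_sub (h + k - r)]
    linear_combination (y ^ r * fallingBinomial q h k r * ℓ (h + k - r - s - 1)) *
      (qInt q (s + 1) * fallingBinomial q h k (s + 1) * pow_triangle_sub_succ_mul q hr hs +
        q ^ triangle ((r : ℤ) - s) * q ^ (k - r) * qInt_mul_fallingBinomial_succ_right q h k s)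

theorem linearizationSum_qInt_left :
    linearizationSum y q h k (fun r s => qInt q r * q ^ (k - r) * ℓ (h + k - r - s)) =
      linearizationSum y q h k fun r s =>
        y * (q ^ (k - s) * qInt q (h - r) * qInt q (k - r) * ℓ (h + k - r - s - 1)) := by
  rw [linearizationSum, linearizationSum, sum_comm]
  conv_rhs => rw [sum_comm]
  refine sum_congr rfl fun s hs =>
    sum_range_succ_shift (by simp only [qInt_zero]; ring) ?_ fun r hr => ?_
  · rw [linearizationCoeff, fallingBinomial_eq_zero_of_lt q h k.lt_succ_self]
    ring
  · rw [mem_range, Nat.lt_succ_iff] at hs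
    simp only [linearizationCoeff, show h + k - (r + 1) - s = h + k - r - s - 1 by omega,
      pow_succ y r]
    rcases hr.eq_or_lt with rfl | hlt
    · rw [fallingBinomial_eq_zero_of_lt q h r.lt_succ_self, Nat.sub_self, qInt_zero]
      ring
    · have hpow : q ^ triangle (((r + 1 : ℕ) : ℤ) - s) * q ^ (k - (r + 1)) =
          q ^ triangle ((r : ℤ) - s) * q ^ (k - s) := by
        have := triangle_add_one ((r : ℤ) - s)
        rw [← pow_add, ← pow_add, show ((r + 1 : ℕ) : ℤ) - s = (r : ℤ) - s + 1 by push_cast; ring]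
        congr 1
        omega
      linear_combination (y ^ r * y * fallingBinomial q h k s * ℓ (h + k - r - s - 1)) *
        (qInt q (r + 1) * fallingBinomial q h k (r + 1) * hpow +
          q ^ triangle ((r : ℤ) - s) * q ^ (k - s) * qInt_mul_fallingBinomial_succ_right q h k r)

theorem qInt_sq_mul_linearizationSum_pred :
    qInt q k ^ 2 * linearizationSum y q h (k - 1) (fun r s => ℓ (h + (k - 1) - r - s)) =
      linearizationSum y q h k fun r s =>
        qInt q (k - r) * qInt q (k - s) * ℓ (h + k - r - s - 1) := by
  cases k with
  | zero => simp only [qInt_zero, linearizationSum_zero, Nat.sub_zero]; ring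
  | succ k =>
    rw [linearizationSum, linearizationSum, sum_range_succ _ (k + 1)]
    simp only [Nat.sub_self, qInt_zero, zero_mul, mul_zero, sum_const_zero, add_zero,
      sum_range_succ _ (k + 1), Nat.add_sub_cancel, mul_sum]
    refine sum_congr rfl fun r _ => sum_congr rfl fun s _ => ?_
    rw [linearizationCoeff, linearizationCoeff,
      show h + (k + 1) - r - s - 1 = h + k - r - s by omega]
    linear_combination (y ^ r * q ^ triangle ((r : ℤ) - s) * ℓ (h + k - r - s)) *
      (qInt q (k + 1) * fallingBinomial q h k s * qInt_mul_fallingBinomial_succ_left q h k r +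
        qInt q (k + 1 - r) * fallingBinomial q h (k + 1) r *
          qInt_mul_fallingBinomial_succ_left q h k s)

/-- The comparison of coefficients behind `mul_linearizationSum`: the terms on the left with the
factors `[r]` and `[s]` and their counterparts on the right cancel after a shift of the summation
index, by `linearizationSum_qInt_left` and `linearizationSum_qInt_right`. -/
theorem threeTerm_termwise {r s : ℕ} (hrk : r ≤ k) (hsk : s ≤ k) (hrh : r ≤ h) (hsh : s ≤ h) :
    (ℓ (h + k - r - s + 1) + (y * q + 1) * qInt q (h + k - r - s) * ℓ (h + k - r - s) +
        y * qInt q (h + k - r - s) ^ 2 * ℓ (h + k - r - s - 1)) +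
      qInt q r * q ^ (k - r) * ℓ (h + k - r - s) +
      y * (qInt q s * q ^ (k + 1 - s) * ℓ (h + k - r - s)) =
    ((ℓ (h + (k + 1) - r - s) +
        y * q ^ (k + 1 - s) * qInt q (h - r) * ℓ (h + (k + 1) - (r + 1) - s)) +
      q ^ (k - r) * qInt q (h - s) * (ℓ (h + (k + 1) - r - (s + 1)) +
        y * q ^ (k - s) * qInt q (h - r) * ℓ (h + (k + 1) - (r + 1) - (s + 1)))) +
      (y * q + 1) * qInt q k * ℓ (h + k - r - s) +
      y * (qInt q (k - r) * qInt q (k - s) * ℓ (h + k - r - s - 1)) +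
      y * (q ^ (k - s) * qInt q (h - r) * qInt q (k - r) * ℓ (h + k - r - s - 1)) +
      y * (q ^ (k - r) * qInt q (h - s) * qInt q (k - s) * ℓ (h + k - r - s - 1)) := by
  have hN_right : qInt q (h + k - r - s) = qInt q (k - s) + q ^ (k - s) * qInt q (h - r) := by
    rw [← qInt_add]; congr 1; omega
  have hN_left : qInt q (h + k - r - s) = qInt q (k - r) + q ^ (k - r) * qInt q (h - s) := by
    rw [← qInt_add]; congr 1; omega
  have hk_right : qInt q k = qInt q (k - s) + q ^ (k - s) * qInt q s := by
    rw [← qInt_add, Nat.sub_add_cancel hsk]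
  have hk_left : qInt q k = qInt q (k - r) + q ^ (k - r) * qInt q r := by
    rw [← qInt_add, Nat.sub_add_cancel hrk]
  rw [show h + (k + 1) - r - s = h + k - r - s + 1 by omega,
    show h + (k + 1) - (r + 1) - s = h + k - r - s by omega,
    show h + (k + 1) - r - (s + 1) = h + k - r - s by omega,
    show h + (k + 1) - (r + 1) - (s + 1) = h + k - r - s - 1 by omega,
    Nat.sub_add_comm hsk, pow_succ']
  generalize h + k - r - s = N at *
  linear_combination y * q * ℓ N * (hN_right - hk_right) + ℓ N * (hN_left - hk_left) +
    y * ℓ (N - 1) * (qInt q N * hN_right +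
      (qInt q (k - s) + q ^ (k - s) * qInt q (h - r)) * hN_left)

theorem mul_linearizationSum
    (hℓ : ∀ n, ℓ 1 * ℓ n =
      ℓ (n + 1) + (y * q + 1) * qInt q n * ℓ n + y * qInt q n ^ 2 * ℓ (n - 1)) :
    ℓ 1 * linearizationSum y q h k (fun r s => ℓ (h + k - r - s)) =
      linearizationSum y q h (k + 1) (fun r s => ℓ (h + (k + 1) - r - s)) +
        (y * q + 1) * qInt q k * linearizationSum y q h k (fun r s => ℓ (h + k - r - s)) +
        y * qInt q k ^ 2 *
          linearizationSum y q h (k - 1) fun r s => ℓ (h + (k - 1) - r - s) := by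
  have hterms := linearizationSum_congr y q fun r s (hrk : r ≤ k) hsk (hrh : r ≤ h) hsh =>
    threeTerm_termwise y q h k ℓ hrk hsk hrh hsh
  simp only [← hℓ, linearizationSum_add, linearizationSum_const_mul] at hterms
  rw [linearizationSum_succ, mul_assoc y, qInt_sq_mul_linearizationSum_pred]
  have hshift_right := linearizationSum_qInt_right y q h k ℓ
  have hshift_left := linearizationSum_qInt_left y q h k ℓ
  simp only [linearizationSum_add, linearizationSum_const_mul] at hshift_left ⊢
  linear_combination hterms - hshift_left - y * hshift_right

end Recurrence

end Linearization

section Laguerre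

variable {R : Type*} [CommRing R] (y q : R)

@[simp] theorem qLaguerre_zero : qLaguerre y q 0 = 1 := by rw [qLaguerre]

theorem qLaguerre_one : qLaguerre y q 1 = X - C y := by simp [qLaguerre]

theorem qLaguerre_one_mul (n : ℕ) :
    qLaguerre y q 1 * qLaguerre y q n = qLaguerre y q (n + 1) +
      (C y * C q + 1) * qInt (C q) n * qLaguerre y q n +
      C y * qInt (C q) n ^ 2 * qLaguerre y q (n - 1) := by
  cases n with
  | zero => simp
  | succ n =>
    rw [show n + 1 + 1 = n + 2 from rfl, qLaguerre.eq_3, qLaguerre_one, qInt_succ q (n + 1)]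
    simp only [C_add, C_mul, C_pow, C_1, map_qInt, Nat.add_sub_cancel]
    ring

theorem qLaguerre_mul (k h : ℕ) : qLaguerre y q k * qLaguerre y q h =
    linearizationSum (C y) (C q) h k fun r s => qLaguerre y q (h + k - r - s) := by
  have hrec := fun k => mul_linearizationSum (C y) (C q) h k _ (qLaguerre_one_mul y q)
  induction k using Nat.twoStepInduction with
  | zero => simp
  | one => simpa using hrec 0
  | more k ih ih_succ =>
    have hrec_succ := hrec (k + 1)
    have hmul := qLaguerre_one_mul y q (k + 1)
    rw [Nat.add_sub_cancel] at hrec_succ hmul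
    rw [← ih, ← ih_succ] at hrec_succ
    linear_combination hrec_succ - qLaguerre y q h * hmul

end Laguerre

/-! ### Rook placements -/

section RookPlacement

variable {α β : Type*}

/-- A set of cells is a rook placement if no two of its cells share a row or a column. -/
def IsRookPlacement (M : Finset (α × β)) : Prop :=
  Set.InjOn Prod.fst (M : Set (α × β)) ∧ Set.InjOn Prod.snd (M : Set (α × β))

open Classical in
/-- The rook placements contained in the board `S`. -/
noncomputable def rooks (S : Finset (α × β)) : Finset (Finset (α × β)) :=
  S.powerset.filter IsRookPlacement

variable {S T M : Finset (α × β)}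

theorem mem_rooks : M ∈ rooks S ↔ M ⊆ S ∧ IsRookPlacement M := by simp [rooks]

theorem rooks_empty : rooks (∅ : Finset (α × β)) = {∅} := by
  ext M
  rw [mem_rooks, subset_empty, mem_singleton, and_iff_left_iff_imp]
  rintro rfl
  simp [IsRookPlacement]

variable [DecidableEq α] [DecidableEq β]

theorem isRookPlacement_insert {t : α × β} (ht : t ∉ M) :
    IsRookPlacement (insert t M) ↔
      IsRookPlacement M ∧ t.1 ∉ M.image Prod.fst ∧ t.2 ∉ M.image Prod.snd := by
  rw [IsRookPlacement, coe_insert, Set.injOn_insert (mod_cast ht), Set.injOn_insert (mod_cast ht),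
    ← coe_image, ← coe_image, mem_coe, mem_coe, IsRookPlacement]
  tauto

variable {A : Type*} [AddCommMonoid A]

theorem sum_rooks_insert {t : α × β} (ht : t ∉ S) (f : Finset (α × β) → A) :
    ∑ M ∈ rooks (insert t S), f M = ∑ M ∈ rooks S, (f M +
      if t.1 ∉ M.image Prod.fst ∧ t.2 ∉ M.image Prod.snd then f (insert t M) else 0) := by
  rw [rooks, sum_filter, sum_powerset_insert ht, ← sum_add_distrib, rooks, sum_filter]
  refine sum_congr rfl fun M hM => ?_
  rw [isRookPlacement_insert fun h => ht (mem_powerset.1 hM h)]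
  split_ifs <;> simp_all

theorem sum_rooks_union (hST : Disjoint S T)
    (hT : ∀ x ∈ T, ∀ z ∈ T, x.1 = z.1 ∨ x.2 = z.2) (f : Finset (α × β) → A) :
    ∑ M ∈ rooks (S ∪ T), f M = ∑ M ∈ rooks S, (f M +
      ∑ t ∈ T with t.1 ∉ M.image Prod.fst ∧ t.2 ∉ M.image Prod.snd, f (insert t M)) := by
  induction T using Finset.induction_on generalizing f with
  | empty => simp
  | insert t T ht ih =>
    rw [disjoint_insert_right] at hST
    have ih := ih hST.2 fun x hx z hz => hT x (mem_insert_of_mem hx) z (mem_insert_of_mem hz)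
    rw [union_insert, sum_rooks_insert (by simp [hST.1, ht]), ih]
    refine sum_congr rfl fun M _ => ?_
    rw [add_assoc, sum_filter, sum_filter, sum_insert ht]
    congr 2
    refine sum_congr rfl fun x hx => ?_
    have hattack := hT x (mem_insert_of_mem hx) t (mem_insert_self t T)
    have not_free : ¬(t.1 ∉ (insert x M).image Prod.fst ∧ t.2 ∉ (insert x M).image Prod.snd) := by
      rw [image_insert, image_insert, mem_insert, mem_insert]
      tauto
    rw [if_neg not_free, add_zero]

theorem sum_rooks_union_row {a : α} {U : Finset β} (ha : ∀ x ∈ S, x.1 ≠ a)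
    (f : Finset (α × β) → A) :
    ∑ M ∈ rooks (S ∪ {a} ×ˢ U), f M =
      ∑ M ∈ rooks S, (f M + ∑ v ∈ U \ M.image Prod.snd, f (insert (a, v) M)) := by
  rw [sum_rooks_union]
  · refine sum_congr rfl fun M hM => ?_
    have haM : a ∉ M.image Prod.fst := fun h => by
      obtain ⟨x, hx, rfl⟩ := mem_image.1 h
      exact ha x ((mem_rooks.1 hM).1 hx) rfl
    simp only [sum_filter, sum_product, sum_singleton, sdiff_eq_filter, haM, not_false_eq_true,
      true_and]
  · exact disjoint_left.2 fun x hx hx' => ha x hx (mem_singleton.1 (mem_product.1 hx').1)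
  · simp +contextual

theorem sum_rooks_union_col {U : Finset α} {b : β} (hb : ∀ x ∈ S, x.2 ≠ b)
    (f : Finset (α × β) → A) :
    ∑ M ∈ rooks (S ∪ U ×ˢ {b}), f M =
      ∑ M ∈ rooks S, (f M + ∑ v ∈ U \ M.image Prod.fst, f (insert (v, b) M)) := by
  rw [sum_rooks_union]
  · refine sum_congr rfl fun M hM => ?_
    have hbM : b ∉ M.image Prod.snd := fun h => by
      obtain ⟨x, hx, rfl⟩ := mem_image.1 h
      exact hb x ((mem_rooks.1 hM).1 hx) rfl
    simp only [sum_filter, sum_product, sum_singleton, sdiff_eq_filter, hbM, not_false_eq_true,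
      and_true]
  · exact disjoint_left.2 fun x hx hx' => hb x hx (mem_singleton.1 (mem_product.1 hx').2)
  · simp +contextual

end RookPlacement

/-! ### The board of a block decomposition -/

section Board

/-- Cells joining two different blocks, when `bs v` is the first element of the block of `v`. -/
def Admissible (bs : ℕ → ℕ) (x : ℕ × ℕ) : Prop := x.1 < bs x.2 ∨ x.2 < bs x.1

instance (bs : ℕ → ℕ) : DecidablePred (Admissible bs) :=
  fun _ => inferInstanceAs (Decidable (_ ∨ _))

/-- The board of admissible cells with `a` rows and `b` columns. -/
def board (bs : ℕ → ℕ) (a b : ℕ) : Finset (ℕ × ℕ) :=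
  (range a ×ˢ range b).filter (Admissible bs)

variable {bs : ℕ → ℕ} {a b c : ℕ}

theorem mem_board {x : ℕ × ℕ} :
    x ∈ board bs a b ↔ x.1 < a ∧ x.2 < b ∧ Admissible bs x := by
  simp [board, and_assoc]

theorem board_succ_left (hbs : ∀ v, bs v ≤ v) (hba : b ≤ a + 1) (hab : bs a ≤ b) :
    board bs (a + 1) b = board bs a b ∪ {a} ×ˢ range (bs a) := by
  ext ⟨i, j⟩
  have := hbs j
  simp only [mem_board, mem_union, mem_product, mem_singleton, mem_range, Admissible]
  grind

theorem board_succ_right (hbs : ∀ v, bs v ≤ v) (hab : a ≤ b + 1) (hba : bs b ≤ a) :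
    board bs a (b + 1) = board bs a b ∪ range (bs b) ×ˢ {b} := by
  ext ⟨i, j⟩
  have := hbs i
  simp only [mem_board, mem_union, mem_product, mem_singleton, mem_range, Admissible]
  grind

theorem fst_lt_or_snd_lt_of_mem_board {d : ℕ} (hc : ∀ v, c ≤ v → v < d → bs v = c) (had : a ≤ d)
    (hbd : b ≤ d) {x : ℕ × ℕ} (hx : x ∈ board bs a b) : x.1 < c ∨ x.2 < c := by
  obtain ⟨hxa, hxb, hx⟩ := mem_board.1 hx
  by_contra! hcx
  rw [Admissible, hc _ hcx.1 (by omega), hc _ hcx.2 (by omega)] at hx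
  omega

variable {A : Type*} [AddCommMonoid A]

theorem sum_rooks_board_succ_left (hbs : ∀ v, bs v ≤ v) (hba : b ≤ a + 1) (hab : bs a ≤ b)
    (f : Finset (ℕ × ℕ) → A) :
    ∑ M ∈ rooks (board bs (a + 1) b), f M = ∑ M ∈ rooks (board bs a b), (f M +
      ∑ v ∈ range (bs a) \ M.image Prod.snd, f (insert (a, v) M)) := by
  rw [board_succ_left hbs hba hab, sum_rooks_union_row fun x hx => (mem_board.1 hx).1.ne]

theorem sum_rooks_board_succ_right (hbs : ∀ v, bs v ≤ v) (hab : a ≤ b + 1) (hba : bs b ≤ a)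
    (f : Finset (ℕ × ℕ) → A) :
    ∑ M ∈ rooks (board bs a (b + 1)), f M = ∑ M ∈ rooks (board bs a b), (f M +
      ∑ v ∈ range (bs b) \ M.image Prod.fst, f (insert (v, b) M)) := by
  rw [board_succ_right hbs hab hba, sum_rooks_union_col fun x hx => (mem_board.1 hx).2.1.ne]

end Board

/-! ### The weight of a placement -/

section Weight

variable {A : Type*} [CommRing A] (y q : A)

/-- The contribution of the cell `x` to the weight of the placement `M`. A cell `(i, j)` is read as
an arc from `i` to `j`: an arc to the right gets a factor `y` and a factor `q` for each arc that
starts inside it and ends to the right of it, an arc to the left a factor `q` for each arc that ends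
inside it and starts to the right of it. Rows and columns that are still empty count as joined to a
point to the right of everything. -/
def cellWeight (M : Finset (ℕ × ℕ)) (x : ℕ × ℕ) : A :=
  if x.1 < x.2 then y * q ^ #{i ∈ Ioc x.1 x.2 | ∀ z ∈ M, z.1 = i → x.2 < z.2}
  else q ^ #{j ∈ Ioo x.2 x.1 | ∀ z ∈ M, z.2 = j → x.1 < z.1}

/-- The weight of a placement. On the graph of a permutation `σ` it takes the value
`y ^ exc σ * q ^ cr σ`. -/
def rookWeight (M : Finset (ℕ × ℕ)) : A := ∏ x ∈ M, cellWeight y q M x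

theorem map_rookWeight {B : Type*} [CommRing B] (f : A →+* B) (M : Finset (ℕ × ℕ)) :
    f (rookWeight y q M) = rookWeight (f y) (f q) M := by
  simp only [rookWeight, map_prod, cellWeight, apply_ite f, map_mul, map_pow]

variable {M : Finset (ℕ × ℕ)} {b : ℕ}

theorem rookWeight_insert_row {v : ℕ} (hM : ∀ x ∈ M, x.1 < b ∧ x.2 < b) (hv : v < b) :
    rookWeight y q (insert (b, v) M) =
      rookWeight y q M * q ^ #(Ioo v b \ M.image Prod.snd) := by
  have hbM : (b, v) ∉ M := fun h => lt_irrefl _ (hM _ h).1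
  have cellWeight_old : ∀ x ∈ M, cellWeight y q (insert (b, v) M) x = cellWeight y q M x := by
    intro x hx
    have := hM x hx
    simp only [cellWeight, forall_mem_insert]
    congr! 4 <;> grind
  have cellWeight_new : cellWeight y q (insert (b, v) M) (b, v) =
      q ^ #(Ioo v b \ M.image Prod.snd) := by
    rw [cellWeight, if_neg hv.not_gt, sdiff_eq_filter]
    congr 2
    refine filter_congr fun j hj => ?_
    simp only [forall_mem_insert, mem_image]
    grind
  rw [rookWeight, prod_insert hbM, cellWeight_new, prod_congr rfl cellWeight_old, mul_comm,
    rookWeight]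

theorem rookWeight_insert_col {o : ℕ} (hM : ∀ x ∈ M, x.1 ≤ b ∧ x.2 < b) (ho : o < b) :
    rookWeight y q (insert (o, b) M) =
      rookWeight y q M * (y * q ^ #(Ioc o b \ M.image Prod.fst)) := by
  have hbM : (o, b) ∉ M := fun h => lt_irrefl _ (hM _ h).2
  have cellWeight_old : ∀ x ∈ M, cellWeight y q (insert (o, b) M) x = cellWeight y q M x := by
    intro x hx
    have := hM x hx
    simp only [cellWeight, forall_mem_insert]
    congr! 4 <;> grind
  have cellWeight_new : cellWeight y q (insert (o, b) M) (o, b) =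
      y * q ^ #(Ioc o b \ M.image Prod.fst) := by
    rw [cellWeight, if_pos ho, sdiff_eq_filter]
    congr 3
    refine filter_congr fun i hi => ?_
    simp only [forall_mem_insert, mem_image]
    grind
  rw [rookWeight, prod_insert hbM, cellWeight_new, prod_congr rfl cellWeight_old, mul_comm,
    rookWeight]

end Weight

/-! ### Adding a block to the board -/

section Block

theorem sum_pow_card_filter_lt {α A : Type*} [LinearOrder α] [CommRing A] (q : A) (U : Finset α) :
    ∑ v ∈ U, q ^ #{w ∈ U | v < w} = qInt q #U := by
  induction U using induction_on_max with
  | empty => simp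
  | insert a U ha ih =>
    have haU : a ∉ U := fun h => lt_irrefl _ (ha a h)
    rw [sum_insert haU, card_insert_of_notMem haU, qInt_succ, ← ih, mul_sum, add_comm]
    congr 1
    · refine sum_congr rfl fun v hv => ?_
      rw [filter_insert, if_pos (ha v hv), card_insert_of_notMem (by simp [haU]), pow_succ']
    · rw [filter_eq_empty_iff.2, card_empty, pow_zero]
      exact (forall_mem_insert _ _ _).2 ⟨lt_irrefl a, fun w hw => (ha w hw).not_gt⟩

theorem sum_pow_card_sdiff {A : Type*} [CommRing A] (q : A) (I : Finset ℕ) {c b : ℕ} (hcb : c ≤ b) :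
    ∑ v ∈ range c \ I, q ^ #(Ico (v + 1) b \ I) =
      q ^ #(Ico c b \ I) * qInt q #(range c \ I) := by
  rw [← sum_pow_card_filter_lt, mul_sum]
  refine sum_congr rfl fun v hv => ?_
  have hdisj : Disjoint (Ico c b \ I) {w ∈ range c \ I | v < w} := by
    rw [disjoint_left]
    grind
  rw [← pow_add, ← card_union_of_disjoint hdisj]
  congr 2
  ext w
  grind

theorem card_sdiff_image {α β : Type*} [DecidableEq β] {M : Finset α} {f : α → β}
    (hf : Set.InjOn f M) (I : Finset β) : #(I \ M.image f) = #I - #{x ∈ M | f x ∈ I} := by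
  rw [card_sdiff, ← card_image_of_injOn (hf.mono (coe_subset.2 (filter_subset _ M)))]
  congr 2
  ext v
  grind

section Count

variable (c : ℕ) (M : Finset (ℕ × ℕ))

/-- The number of cells of `M` with both coordinates below `c`. -/
def lowCount : ℕ := #{x ∈ M | x.1 < c ∧ x.2 < c}

/-- The number of cells of `M` in a column at or after `c`. -/
def colCount : ℕ := #{x ∈ M | c ≤ x.2}

/-- The number of cells of `M` in a row at or after `c`. -/
def rowCount : ℕ := #{x ∈ M | c ≤ x.1}

variable {c M}

theorem card_filter_fst_lt (hM : ∀ x ∈ M, x.1 < c ∨ x.2 < c) :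
    #{x ∈ M | x.1 < c} = lowCount c M + colCount c M := by
  rw [← card_filter_add_card_filter_not (s := {x ∈ M | x.1 < c}) fun x => x.2 < c, filter_filter,
    filter_filter, lowCount, colCount]
  congr 2
  exact filter_congr fun x hx => by have := hM x hx; omega

theorem card_filter_snd_lt (hM : ∀ x ∈ M, x.1 < c ∨ x.2 < c) :
    #{x ∈ M | x.2 < c} = lowCount c M + rowCount c M := by
  rw [← card_filter_add_card_filter_not (s := {x ∈ M | x.2 < c}) fun x => x.1 < c, filter_filter,
    filter_filter, lowCount, rowCount]
  congr 2 <;> exact filter_congr fun x hx => by have := hM x hx; omega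

theorem card_eq_lowCount_add (hM : ∀ x ∈ M, x.1 < c ∨ x.2 < c) :
    #M = lowCount c M + colCount c M + rowCount c M := by
  rw [← card_filter_fst_lt hM, rowCount,
    ← card_filter_add_card_filter_not (s := M) fun x => x.1 < c]
  simp only [not_lt]

theorem lowCount_le (hM : IsRookPlacement M) : lowCount c M ≤ c := by
  have := card_le_card_of_injOn (s := {x ∈ M | x.1 < c ∧ x.2 < c}) (t := range c) Prod.fst
    (fun x hx => mem_coe.2 (mem_range.2 (mem_filter.1 (mem_coe.1 hx)).2.1))
    (hM.1.mono (coe_subset.2 (filter_subset _ M)))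
  rwa [card_range] at this

section Insert

variable {t : ℕ × ℕ}

theorem lowCount_insert_of_le (h : c ≤ t.1 ∨ c ≤ t.2) : lowCount c (insert t M) = lowCount c M := by
  rw [lowCount, filter_insert, if_neg (by omega), lowCount]

theorem colCount_insert_of_lt (h : t.2 < c) : colCount c (insert t M) = colCount c M := by
  rw [colCount, filter_insert, if_neg h.not_ge, colCount]

theorem rowCount_insert_of_lt (h : t.1 < c) : rowCount c (insert t M) = rowCount c M := by
  rw [rowCount, filter_insert, if_neg h.not_ge, rowCount]

theorem colCount_insert_of_le (h : c ≤ t.2) (ht : t ∉ M) :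
    colCount c (insert t M) = colCount c M + 1 := by
  rw [colCount, filter_insert, if_pos h, card_insert_of_notMem (by simp [ht]), colCount]

theorem rowCount_insert_of_le (h : c ≤ t.1) (ht : t ∉ M) :
    rowCount c (insert t M) = rowCount c M + 1 := by
  rw [rowCount, filter_insert, if_pos h, card_insert_of_notMem (by simp [ht]), rowCount]

end Insert

end Count

variable {A : Type*} [CommRing A] (y q : A) (bs : ℕ → ℕ) (c : ℕ)

/-- The generating function of the rook placements on a board, in which a placement is weighted, in
addition to its `rookWeight`, by a function `Φ` of its numbers of cells before and after the start
`c` of the last block. -/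
noncomputable def rookSum (a b : ℕ) (Φ : ℕ → ℕ → ℕ → A) : A :=
  ∑ M ∈ rooks (board bs a b),
    rookWeight y q M * Φ (lowCount c M) (colCount c M) (rowCount c M)

variable {bs c} {b : ℕ}

theorem rookSum_succ_left (hbs : ∀ v, bs v ≤ v) (hcb : c ≤ b)
    (hc : ∀ v, c ≤ v → v ≤ b → bs v = c) (Φ : ℕ → ℕ → ℕ → A) :
    rookSum y q bs c (b + 1) b Φ = rookSum y q bs c b b fun l r s =>
      Φ l r s + q ^ (b - c - r) * qInt q (c - l - s) * Φ l r (s + 1) := by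
  have hbc : bs b = c := hc b hcb le_rfl
  rw [rookSum, sum_rooks_board_succ_left hbs b.le_succ (hbc.trans_le hcb), hbc]
  refine sum_congr rfl fun M hM => ?_
  obtain ⟨hMboard, hMrook⟩ := mem_rooks.1 hM
  have hlt : ∀ x ∈ M, x.1 < b ∧ x.2 < b := fun x hx =>
    have := mem_board.1 (hMboard hx); ⟨this.1, this.2.1⟩
  have hlow : ∀ x ∈ M, x.1 < c ∨ x.2 < c := fun x hx => fst_lt_or_snd_lt_of_mem_board
    (fun v hcv hvb => hc v hcv (Nat.lt_succ_iff.1 hvb)) b.le_succ b.le_succ (hMboard hx)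
  have hcol : #(Ico c b \ M.image Prod.snd) = b - c - colCount c M := by
    rw [card_sdiff_image hMrook.2, Nat.card_Ico, colCount]
    congr 2
    exact filter_congr fun x hx => by have := hlt x hx; rw [mem_Ico]; omega
  have hrow : #(range c \ M.image Prod.snd) = c - lowCount c M - rowCount c M := by
    simp only [card_sdiff_image hMrook.2, card_range, mem_range, card_filter_snd_lt hlow,
      Nat.sub_sub]
  have hinsert : ∀ v ∈ range c \ M.image Prod.snd, rookWeight y q (insert (b, v) M) *
      Φ (lowCount c (insert (b, v) M)) (colCount c (insert (b, v) M))
        (rowCount c (insert (b, v) M)) =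
      rookWeight y q M * q ^ #(Ico (v + 1) b \ M.image Prod.snd) *
        Φ (lowCount c M) (colCount c M) (rowCount c M + 1) := fun v hv => by
    have hvc : v < c := mem_range.1 (mem_sdiff.1 hv).1
    rw [rookWeight_insert_row y q hlt (hvc.trans_le hcb), lowCount_insert_of_le (Or.inl hcb),
      colCount_insert_of_lt hvc, rowCount_insert_of_le hcb fun h => lt_irrefl _ (hlt _ h).1]
    rfl
  rw [sum_congr rfl hinsert, ← sum_mul, ← mul_sum, sum_pow_card_sdiff q _ hcb, hcol, hrow]
  ring

theorem rookSum_succ_right (hbs : ∀ v, bs v ≤ v) (hcb : c ≤ b)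
    (hc : ∀ v, c ≤ v → v ≤ b → bs v = c) (Φ : ℕ → ℕ → ℕ → A) :
    rookSum y q bs c (b + 1) (b + 1) Φ = rookSum y q bs c (b + 1) b fun l r s =>
      Φ l r s + y * q ^ (b + 1 - c - s) * qInt q (c - l - r) * Φ l (r + 1) s := by
  have hbc : bs b = c := hc b hcb le_rfl
  rw [rookSum, sum_rooks_board_succ_right hbs le_rfl (by omega), hbc]
  refine sum_congr rfl fun M hM => ?_
  obtain ⟨hMboard, hMrook⟩ := mem_rooks.1 hM
  have hlt : ∀ x ∈ M, x.1 ≤ b ∧ x.2 < b := fun x hx =>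
    have := mem_board.1 (hMboard hx); ⟨Nat.lt_succ_iff.1 this.1, this.2.1⟩
  have hlow : ∀ x ∈ M, x.1 < c ∨ x.2 < c := fun x hx => fst_lt_or_snd_lt_of_mem_board
    (fun v hcv hvb => hc v hcv (Nat.lt_succ_iff.1 hvb)) le_rfl b.le_succ (hMboard hx)
  have hrow : #(Ico c (b + 1) \ M.image Prod.fst) = b + 1 - c - rowCount c M := by
    rw [card_sdiff_image hMrook.1, Nat.card_Ico, rowCount]
    congr 2
    exact filter_congr fun x hx => by have := hlt x hx; rw [mem_Ico]; omega
  have hcol : #(range c \ M.image Prod.fst) = c - lowCount c M - colCount c M := by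
    simp only [card_sdiff_image hMrook.1, card_range, mem_range, card_filter_fst_lt hlow,
      Nat.sub_sub]
  have hinsert : ∀ v ∈ range c \ M.image Prod.fst, rookWeight y q (insert (v, b) M) *
      Φ (lowCount c (insert (v, b) M)) (colCount c (insert (v, b) M))
        (rowCount c (insert (v, b) M)) =
      rookWeight y q M * y * q ^ #(Ico (v + 1) (b + 1) \ M.image Prod.fst) *
        Φ (lowCount c M) (colCount c M + 1) (rowCount c M) := fun v hv => by
    have hvc : v < c := mem_range.1 (mem_sdiff.1 hv).1
    rw [rookWeight_insert_col y q hlt (hvc.trans_le hcb), lowCount_insert_of_le (Or.inr hcb),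
      rowCount_insert_of_lt hvc, colCount_insert_of_le hcb fun h => lt_irrefl _ (hlt _ h).2,
      ← mul_assoc, Ico_add_one_add_one_eq_Ioc]
  rw [sum_congr rfl hinsert, ← sum_mul, ← mul_sum, sum_pow_card_sdiff q _ (hcb.trans b.le_succ),
    hrow, hcol]
  ring

theorem rookSum_block (hbs : ∀ v, bs v ≤ v) (k : ℕ) (hc : ∀ v, c ≤ v → v < c + k → bs v = c)
    (Φ : ℕ → ℕ → ℕ → A) :
    rookSum y q bs c (c + k) (c + k) Φ = ∑ M ∈ rooks (board bs c c),
      rookWeight y q M * linearizationSum y q (c - #M) k (Φ #M) := by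
  induction k generalizing Φ with
  | zero =>
    refine sum_congr rfl fun M hM => ?_
    have hlt : ∀ x ∈ M, x.1 < c ∧ x.2 < c := fun x hx =>
      have := mem_board.1 ((mem_rooks.1 hM).1 hx); ⟨this.1, this.2.1⟩
    have hlow : lowCount c M = #M := by rw [lowCount, filter_true_of_mem hlt]
    have := card_eq_lowCount_add fun x hx => Or.inl (hlt x hx).1
    rw [linearizationSum_zero, hlow, show colCount c M = 0 by omega,
      show rowCount c M = 0 by omega]
  | succ k ih =>
    have hlast : ∀ v, c ≤ v → v ≤ c + k → bs v = c := fun v hcv hvk => hc v hcv (by omega)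
    rw [← add_assoc, rookSum_succ_right y q hbs (c.le_add_right k) hlast,
      rookSum_succ_left y q hbs (c.le_add_right k) hlast,
      ih fun v hcv hvk => hc v hcv (by omega)]
    refine sum_congr rfl fun M _ => ?_
    rw [linearizationSum_succ]
    simp only [add_assoc, Nat.add_sub_cancel_left, Nat.add_sub_add_right]

end Block

theorem sum_rooks_board_eq_prod {R : Type*} [CommRing R] (y q : R) {bs : ℕ → ℕ}
    (hbs : ∀ v, bs v ≤ v) (n : ℕ → ℕ) (m : ℕ)
    (hn : ∀ i < m, ∀ v, ∑ j ∈ range i, n j ≤ v → v < ∑ j ∈ range (i + 1), n j →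
      bs v = ∑ j ∈ range i, n j) :
    ∑ M ∈ rooks (board bs (∑ j ∈ range m, n j) (∑ j ∈ range m, n j)),
        rookWeight (C y) (C q) M * qLaguerre y q ((∑ j ∈ range m, n j) - #M) =
      ∏ j ∈ range m, qLaguerre y q (n j) := by
  induction m with
  | zero => simp [board, rooks_empty, rookWeight]
  | succ m ih =>
    have hm := hn m m.lt_succ_self
    rw [prod_range_succ, ← ih fun i hi => hn i (by omega), sum_mul]
    simp only [sum_range_succ _ m] at hm ⊢
    generalize ∑ j ∈ range m, n j = c at *
    have hdegree : ∀ M ∈ rooks (board bs (c + n m) (c + n m)), c + n m - #M =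
        c - lowCount c M + n m - colCount c M - rowCount c M := fun M hM => by
      obtain ⟨hMboard, hMrook⟩ := mem_rooks.1 hM
      have := card_eq_lowCount_add fun x hx =>
        fst_lt_or_snd_lt_of_mem_board hm le_rfl le_rfl (hMboard hx)
      have := lowCount_le (c := c) hMrook
      omega
    rw [sum_congr rfl fun M hM => by rw [hdegree M hM]]
    refine (rookSum_block (C y) (C q) hbs (n m) hm fun l r s =>
      qLaguerre y q (c - l + n m - r - s)).trans (sum_congr rfl fun M _ => ?_)
    rw [← qLaguerre_mul]
    ring

/-! ### Derangements as full placements -/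

section Box

variable {m : ℕ} (n : Fin m → ℕ)

/-- The sizes of the boxes, extended by zero. -/
def boxSize (j : ℕ) : ℕ := if h : j < m then n ⟨j, h⟩ else 0

/-- The first element of the box with index `i`. -/
def boxStart (i : ℕ) : ℕ := ∑ j ∈ range i, boxSize n j

/-- The first element of the box that contains `v`. -/
def boxStartOf (v : ℕ) : ℕ := {i ∈ range (m + 1) | boxStart n i ≤ v}.sup (boxStart n)

theorem boxSize_val (j : Fin m) : boxSize n j = n j := by simp [boxSize]

theorem boxStart_mono : Monotone (boxStart n) := fun _ _ h =>
  sum_le_sum_of_subset (range_subset_range.2 h)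

theorem boxStart_eq_sum : boxStart n m = ∑ i, n i := by
  simp only [boxStart, sum_range, boxSize_val]

theorem sum_Iio_eq_boxStart (j : Fin m) : ∑ i ∈ Iio j, n i = boxStart n j := by
  rw [boxStart, ← Nat.Iio_eq_range, ← Fin.map_valEmbedding_Iio, sum_map]
  simp [boxSize_val]

theorem sum_Iic_eq_boxStart (j : Fin m) : ∑ i ∈ Iic j, n i = boxStart n (j + 1) := by
  rw [boxStart, Nat.range_succ_eq_Iic, ← Fin.map_valEmbedding_Iic, sum_map]
  simp [boxSize_val]

theorem boxStartOf_le (v : ℕ) : boxStartOf n v ≤ v :=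
  Finset.sup_le fun _ hi => (mem_filter.1 hi).2

theorem boxStart_le_boxStartOf {i v : ℕ} (him : i ≤ m) (hv : boxStart n i ≤ v) :
    boxStart n i ≤ boxStartOf n v :=
  le_sup (f := boxStart n) (mem_filter.2 ⟨mem_range.2 (Nat.lt_succ_of_le him), hv⟩)

theorem boxStartOf_eq {i v : ℕ} (him : i < m) (hiv : boxStart n i ≤ v)
    (hvi : v < boxStart n (i + 1)) : boxStartOf n v = boxStart n i := by
  refine le_antisymm (Finset.sup_le fun j hj => boxStart_mono n ?_)
    (boxStart_le_boxStartOf n him.le hiv)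
  by_contra! hij
  exact ((mem_filter.1 hj).2.trans_lt hvi).not_ge (boxStart_mono n hij)

theorem exists_boxStart_le_lt {k v : ℕ} (hv : v < boxStart n k) :
    ∃ i < k, boxStart n i ≤ v ∧ v < boxStart n (i + 1) := by
  induction k with
  | zero => simp [boxStart] at hv
  | succ k ih =>
    by_cases hvk : v < boxStart n k
    · obtain ⟨i, hik, hi⟩ := ih hvk
      exact ⟨i, hik.trans k.lt_succ_self, hi⟩
    · exact ⟨k, k.lt_succ_self, not_lt.1 hvk, hv⟩

theorem mem_box {j : Fin m} {k : Fin (∑ i, n i)} :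
    k ∈ box n j ↔ boxStart n j ≤ k ∧ (k : ℕ) < boxStart n (j + 1) := by
  simp [box, sum_Iio_eq_boxStart, sum_Iic_eq_boxStart]

theorem mem_inhomDerangements {σ : Equiv.Perm (Fin (∑ i, n i))} :
    σ ∈ inhomDerangements n ↔
      ∀ k : Fin (∑ i, n i), Admissible (boxStartOf n) ((k : ℕ), (σ k : ℕ)) := by
  simp only [inhomDerangements, mem_filter, mem_univ, true_and, ← disjoint_iff_inter_eq_empty,
    disjoint_left, forall_mem_image, mem_box, Admissible]
  constructor
  · intro hσ k
    obtain ⟨i, him, hik, hki⟩ := exists_boxStart_le_lt n (k.2.trans_eq (boxStart_eq_sum n).symm)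
    rw [boxStartOf_eq n him hik hki]
    by_contra! hk
    have hσi : ¬(boxStart n i ≤ σ k ∧ (σ k : ℕ) < boxStart n (i + 1)) :=
      hσ ⟨i, him⟩ ⟨hik, hki⟩
    have := boxStart_le_boxStartOf n him (not_lt.1 fun hlt => hσi ⟨hk.2, hlt⟩)
    exact hk.1.not_gt (hki.trans_le this)
  · intro hσ j k hk hσk
    have := hσ k
    rw [boxStartOf_eq n j.2 hk.1 hk.2, boxStartOf_eq n j.2 hσk.1 hσk.2] at this
    omega

end Box

section Graph

variable {N : ℕ}

/-- The graph of a permutation, as a set of cells. -/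
def graph (σ : Equiv.Perm (Fin N)) : Finset (ℕ × ℕ) :=
  univ.image fun i : Fin N => ((i : ℕ), (σ i : ℕ))

theorem mem_graph {σ : Equiv.Perm (Fin N)} {x : ℕ × ℕ} :
    x ∈ graph σ ↔ ∃ i : Fin N, ((i : ℕ), (σ i : ℕ)) = x := by
  simp [graph]

theorem injective_graphCell (σ : Equiv.Perm (Fin N)) :
    Function.Injective fun i : Fin N => ((i : ℕ), (σ i : ℕ)) :=
  fun _ _ h => Fin.ext (Prod.mk.inj h).1

theorem graph_injective : Function.Injective (graph (N := N)) := by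
  intro σ τ h
  ext i
  have hi : ((i : ℕ), (σ i : ℕ)) ∈ graph τ := h ▸ mem_graph.2 ⟨i, rfl⟩
  obtain ⟨j, hj⟩ := mem_graph.1 hi
  rw [Prod.mk.injEq] at hj
  obtain rfl : j = i := Fin.ext hj.1
  exact hj.2.symm

theorem card_graph (σ : Equiv.Perm (Fin N)) : #(graph σ) = N := by
  rw [graph, card_image_of_injective _ (injective_graphCell σ), card_univ, Fintype.card_fin]

theorem isRookPlacement_graph (σ : Equiv.Perm (Fin N)) : IsRookPlacement (graph σ) := by
  simp only [IsRookPlacement, graph, coe_image, coe_univ, Set.image_univ]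
  constructor
  · rintro _ ⟨i, rfl⟩ _ ⟨j, rfl⟩ h
    rw [Fin.ext h]
  · rintro _ ⟨i, rfl⟩ _ ⟨j, rfl⟩ h
    rw [σ.injective (Fin.ext h)]

theorem exists_graph_eq {M : Finset (ℕ × ℕ)} (hM : IsRookPlacement M)
    (hlt : ∀ x ∈ M, x.1 < N ∧ x.2 < N) (hcard : #M = N) :
    ∃ σ : Equiv.Perm (Fin N), graph σ = M := by
  have himage : M.image Prod.fst = range N := by
    refine eq_of_subset_of_card_le (image_subset_iff.2 fun x hx => mem_range.2 (hlt x hx).1) ?_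
    rw [card_image_of_injOn hM.1, hcard, card_range]
  have hrow : ∀ i : Fin N, ∃ j : Fin N, ((i : ℕ), (j : ℕ)) ∈ M := fun i => by
    obtain ⟨x, hx, hxi⟩ := mem_image.1 (himage ▸ mem_range.2 i.2)
    exact ⟨⟨x.2, (hlt x hx).2⟩, hxi ▸ hx⟩
  choose f hf using hrow
  have hf_injective : Function.Injective f := fun i j hij =>
    Fin.ext (Prod.mk.inj (hM.2 (hf i) (hf j) (congrArg Fin.val hij))).1
  refine ⟨Equiv.ofBijective f (Finite.injective_iff_bijective.1 hf_injective), ?_⟩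
  refine eq_of_subset_of_card_le (fun x hx => ?_) (by rw [card_graph, hcard])
  obtain ⟨i, rfl⟩ := mem_graph.1 hx
  exact hf i

variable {A : Type*} [CommRing A] (y q : A) (σ : Equiv.Perm (Fin N))

theorem card_filter_Ioc_graph (i : Fin N) :
    #{v ∈ Ioc (i : ℕ) (σ i) | ∀ z ∈ graph σ, z.1 = v → (σ i : ℕ) < z.2} =
      #{j | i < j ∧ j ≤ σ i ∧ σ i < σ j} := by
  rw [← card_map Fin.valEmbedding]
  congr 1
  ext v
  simp only [mem_filter, mem_Ioc, mem_map, mem_univ, true_and, mem_graph, Fin.valEmbedding_apply]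
  constructor
  · rintro ⟨⟨hiv, hvi⟩, hv⟩
    exact ⟨⟨v, hvi.trans_lt (σ i).2⟩, ⟨hiv, hvi, hv _ ⟨_, rfl⟩ rfl⟩, rfl⟩
  · rintro ⟨j, hj, rfl⟩
    refine ⟨⟨hj.1, hj.2.1⟩, ?_⟩
    rintro _ ⟨k, rfl⟩ hkj
    rw [Fin.ext hkj]
    exact hj.2.2

theorem card_filter_Ioo_graph (i : Fin N) :
    #{v ∈ Ioo (σ i : ℕ) i | ∀ z ∈ graph σ, z.2 = v → (i : ℕ) < z.1} =
      #{j | j > i ∧ i > σ j ∧ σ j > σ i} := by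
  rw [← card_map (σ.toEmbedding.trans Fin.valEmbedding)]
  congr 1
  ext v
  simp only [mem_filter, mem_Ioo, mem_map, mem_univ, true_and, mem_graph,
    Function.Embedding.trans_apply, Equiv.toEmbedding_apply, Fin.valEmbedding_apply]
  constructor
  · rintro ⟨⟨hiv, hvi⟩, hv⟩
    obtain ⟨j, hj⟩ := σ.surjective ⟨v, hvi.trans i.2⟩
    obtain rfl : (σ j : ℕ) = v := congrArg Fin.val hj
    exact ⟨j, ⟨hv _ ⟨j, rfl⟩ rfl, hvi, hiv⟩, rfl⟩
  · rintro ⟨j, hj, rfl⟩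
    refine ⟨⟨hj.2.2, hj.2.1⟩, ?_⟩
    rintro _ ⟨k, rfl⟩ hkj
    rw [σ.injective (Fin.ext hkj)]
    exact hj.1

theorem cellWeight_graph (i : Fin N) :
    cellWeight y q (graph σ) ((i : ℕ), (σ i : ℕ)) =
      (if i < σ i then y else 1) * q ^ (#{j | i < j ∧ j ≤ σ i ∧ σ i < σ j} +
        #{j | j > i ∧ i > σ j ∧ σ j > σ i}) := by
  rw [cellWeight, card_filter_Ioc_graph, card_filter_Ioo_graph]
  simp only [Fin.val_fin_lt]
  split_ifs with h
  · rw [filter_eq_empty_iff.2 fun j _ (hj : j > i ∧ i > σ j ∧ σ j > σ i) =>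
      (hj.2.2.trans hj.2.1).not_gt h, card_empty, add_zero]
  · rw [filter_eq_empty_iff.2 fun j _ (hj : i < j ∧ j ≤ σ i ∧ σ i < σ j) =>
      h (hj.1.trans_le hj.2.1), card_empty, zero_add, one_mul]

theorem rookWeight_graph : rookWeight y q (graph σ) = y ^ exc σ * q ^ cr σ := by
  have hcr : ∑ i, #{j | i < j ∧ j ≤ σ i ∧ σ i < σ j} =
      ∑ i, #{j | j < i ∧ i ≤ σ j ∧ σ j < σ i} := by
    simp only [card_filter]
    exact sum_comm
  rw [rookWeight]
  nth_rw 1 [graph]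
  rw [prod_image (injective_graphCell σ).injOn,
    prod_congr rfl fun i _ => cellWeight_graph y q σ i, prod_mul_distrib, prod_pow_eq_pow_sum,
    sum_add_distrib, hcr, prod_ite, prod_const, prod_const_one, mul_one, exc, cr]

end Graph

section Derangement

variable {R : Type*} [CommRing R] (y q : R) {m : ℕ} (n : Fin m → ℕ)

theorem derangementSum_eq_sum_rooks :
    derangementSum y q n =
      ∑ M ∈ rooks (board (boxStartOf n) (∑ i, n i) (∑ i, n i)) with #M = ∑ i, n i,
        rookWeight y q M := by
  rw [derangementSum]
  refine sum_bij (fun σ _ => graph σ) (fun σ hσ => ?_) (fun _ _ _ _ h => graph_injective h)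
    (fun M hM => ?_) fun σ _ => (rookWeight_graph y q σ).symm
  · rw [mem_inhomDerangements] at hσ
    refine mem_filter.2 ⟨mem_rooks.2 ⟨fun x hx => ?_, isRookPlacement_graph σ⟩, card_graph σ⟩
    obtain ⟨i, rfl⟩ := mem_graph.1 hx
    exact mem_board.2 ⟨i.2, (σ i).2, hσ i⟩
  · obtain ⟨hM, hcard⟩ := mem_filter.1 hM
    obtain ⟨hMboard, hMrook⟩ := mem_rooks.1 hM
    obtain ⟨σ, rfl⟩ := exists_graph_eq hMrook
      (fun x hx => have := mem_board.1 (hMboard hx); ⟨this.1, this.2.1⟩) hcard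
    exact ⟨σ, (mem_inhomDerangements n).2 fun k =>
      (mem_board.1 (hMboard (mem_graph.2 ⟨k, rfl⟩))).2.2, rfl⟩

theorem sum_rooks_eq_prod_qLaguerre :
    ∑ M ∈ rooks (board (boxStartOf n) (∑ i, n i) (∑ i, n i)),
        rookWeight (C y) (C q) M * qLaguerre y q (∑ i, n i - #M) =
      ∏ j, qLaguerre y q (n j) := by
  rw [← boxStart_eq_sum, boxStart, sum_rooks_board_eq_prod y q (boxStartOf_le n) (boxSize n) m
    fun i hi v => boxStartOf_eq n hi, prod_range]
  simp only [boxSize_val]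

theorem derangementSum_eq_of_vanishing (Λ : R[X] →ₗ[R] R) (hone : Λ 1 = 1)
    (hvanish : ∀ k ≠ 0, Λ (qLaguerre y q k) = 0) :
    derangementSum y q n = Λ (∏ j, qLaguerre y q (n j)) := by
  rw [← sum_rooks_eq_prod_qLaguerre, map_sum, derangementSum_eq_sum_rooks, sum_filter]
  refine sum_congr rfl fun M hM => ?_
  obtain ⟨hMboard, hMrook⟩ := mem_rooks.1 hM
  have hcard : #M ≤ ∑ i, n i := by
    simpa using card_le_card_of_injOn (t := range (∑ i, n i)) Prod.fst
      (fun x hx => by simpa using (mem_board.1 (hMboard hx)).1) hMrook.1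
  rw [← map_rookWeight, ← smul_eq_C_mul, map_smul, smul_eq_mul]
  split_ifs with h
  · rw [h, Nat.sub_self, qLaguerre_zero, hone, mul_one]
  · rw [hvanish _ (by omega), mul_zero]

theorem derangementSum_eq_of_isOrthogonalityFunctional (Λ : R[X] →ₗ[R] R)
    (hΛ : IsOrthogonalityFunctional y q Λ) :
    derangementSum y q n = Λ (∏ j, qLaguerre y q (n j)) :=
  derangementSum_eq_of_vanishing y q n Λ hΛ.1 fun k hk => by
    simpa only [qLaguerre_zero, mul_one] using hΛ.2 k 0 hk

end Derangement

/-! ### Continuous `q`-Hermite polynomials -/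

section QFactorial

variable {q : ℝ}

/-- The finite `q`-shifted factorial `(q; q)_n`. -/
def qFact (q : ℝ) (n : ℕ) : ℝ := ∏ i ∈ range n, (1 - q ^ (i + 1))

/-- The reciprocal `1 / (q; q)_n`. -/
noncomputable def invQFact (q : ℝ) (n : ℕ) : ℝ := (qFact q n)⁻¹

/-- The reciprocal `1 / (q; q)_m`, extended by zero to the negative integers. -/
noncomputable def invQFactInt (q : ℝ) (m : ℤ) : ℝ := if 0 ≤ m then invQFact q m.toNat else 0

theorem abs_pow_lt_one (hq : |q| < 1) {n : ℕ} (hn : n ≠ 0) : |q ^ n| < 1 := by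
  rw [abs_pow]
  exact pow_lt_one₀ (abs_nonneg q) hq hn

theorem one_sub_pow_pos (hq : |q| < 1) {n : ℕ} (hn : n ≠ 0) : 0 < 1 - q ^ n :=
  sub_pos.2 ((le_abs_self _).trans_lt (abs_pow_lt_one hq hn))

theorem one_add_pow_pos (hq : |q| < 1) (n : ℕ) : 0 < 1 + q ^ n := by
  rcases eq_or_ne n 0 with rfl | hn
  · norm_num
  · linarith [neg_abs_le (q ^ n), abs_pow_lt_one hq hn]

theorem qFact_pos (hq : |q| < 1) (n : ℕ) : 0 < qFact q n :=
  prod_pos fun i _ => one_sub_pow_pos hq i.succ_ne_zero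

theorem qFact_succ (q : ℝ) (n : ℕ) : qFact q (n + 1) = qFact q n * (1 - q ^ (n + 1)) :=
  prod_range_succ _ _

@[simp] theorem qFact_zero (q : ℝ) : qFact q 0 = 1 := prod_range_zero _

@[simp] theorem invQFact_zero (q : ℝ) : invQFact q 0 = 1 := by simp [invQFact]

theorem invQFact_pos (hq : |q| < 1) (n : ℕ) : 0 < invQFact q n := inv_pos.2 (qFact_pos hq n)

theorem one_sub_pow_mul_invQFact (hq : |q| < 1) (n : ℕ) :
    (1 - q ^ (n + 1)) * invQFact q (n + 1) = invQFact q n := by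
  rw [invQFact, qFact_succ, mul_inv_rev, ← mul_assoc,
    mul_inv_cancel₀ (one_sub_pow_pos hq n.succ_ne_zero).ne', one_mul, invQFact]

theorem invQFactInt_natCast (q : ℝ) (n : ℕ) : invQFactInt q n = invQFact q n := by
  simp [invQFactInt]

theorem invQFactInt_of_neg (q : ℝ) {m : ℤ} (hm : m < 0) : invQFactInt q m = 0 :=
  if_neg hm.not_ge

theorem invQFactInt_sub_one (hq : |q| < 1) (n : ℕ) :
    invQFactInt q ((n : ℤ) - 1) = (1 - q ^ n) * invQFact q n := by
  cases n with
  | zero => simp [invQFactInt]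
  | succ n =>
    rw [one_sub_pow_mul_invQFact hq, Nat.cast_succ, add_sub_cancel_right, invQFactInt_natCast]

theorem mul_invQFactInt_sub_two (hq : |q| < 1) (n : ℕ) :
    q * invQFactInt q ((n : ℤ) - 1 - 1) = (q - q ^ n) * ((1 - q ^ n) * invQFact q n) := by
  cases n with
  | zero => simp [invQFactInt]
  | succ n =>
    rw [one_sub_pow_mul_invQFact hq, Nat.cast_succ, add_sub_cancel_right, invQFactInt_sub_one hq]
    ring

theorem sum_antidiagonal_one_sub_pow_fst (hq : |q| < 1) (n : ℕ) (F : ℕ → ℕ → ℝ) :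
    ∑ x ∈ antidiagonal (n + 1), (1 - q ^ x.1) * invQFact q x.1 * F x.1 x.2 =
      ∑ x ∈ antidiagonal n, invQFact q x.1 * F (x.1 + 1) x.2 := by
  rw [Nat.sum_antidiagonal_succ]
  simp [one_sub_pow_mul_invQFact hq]

theorem sum_antidiagonal_one_sub_pow_snd (hq : |q| < 1) (n : ℕ) (F : ℕ → ℕ → ℝ) :
    ∑ x ∈ antidiagonal (n + 1), (1 - q ^ x.2) * invQFact q x.2 * F x.1 x.2 =
      ∑ x ∈ antidiagonal n, invQFact q x.2 * F x.1 (x.2 + 1) := by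
  rw [Nat.sum_antidiagonal_succ']
  simp [one_sub_pow_mul_invQFact hq]

theorem one_sub_pow_mul_sum_antidiagonal (hq : |q| < 1) (n : ℕ) (F : ℕ → ℕ → ℝ) :
    (1 - q ^ (n + 1)) * ∑ x ∈ antidiagonal (n + 1), invQFact q x.1 * invQFact q x.2 * F x.1 x.2 =
      ∑ x ∈ antidiagonal n, invQFact q x.1 * invQFact q x.2 *
        (F x.1 (x.2 + 1) + q ^ x.2 * F (x.1 + 1) x.2) := by
  calc (1 - q ^ (n + 1)) *
        ∑ x ∈ antidiagonal (n + 1), invQFact q x.1 * invQFact q x.2 * F x.1 x.2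
      = ∑ x ∈ antidiagonal (n + 1),
            (1 - q ^ x.2) * invQFact q x.2 * (invQFact q x.1 * F x.1 x.2) +
          ∑ x ∈ antidiagonal (n + 1),
            (1 - q ^ x.1) * invQFact q x.1 * (invQFact q x.2 * q ^ x.2 * F x.1 x.2) := by
        rw [mul_sum, ← sum_add_distrib]
        refine sum_congr rfl fun x hx => ?_
        rw [← mem_antidiagonal.1 hx, pow_add]
        ring
    _ = _ := by
        rw [sum_antidiagonal_one_sub_pow_snd hq n fun i j => invQFact q i * F i j,
          sum_antidiagonal_one_sub_pow_fst hq n fun i j => invQFact q j * q ^ j * F i j,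
          ← sum_add_distrib]
        exact sum_congr rfl fun x _ => by ring

/-- An alternating sum of Gaussian binomial coefficients, divided by `(q; q)_n`. -/
noncomputable def altSum (q : ℝ) (n p : ℕ) : ℝ :=
  ∑ x ∈ antidiagonal n,
    invQFact q x.1 * invQFact q x.2 * ((-1) ^ x.1 * q ^ triangle ((x.1 : ℤ) - p - 1))

theorem altSum_succ (hq : |q| < 1) {n p : ℕ} (hp : p ≤ n) :
    (1 - q ^ (n + 1)) * altSum q (n + 1) p = (1 - q ^ (n - p)) * altSum q n p := by
  rw [altSum, one_sub_pow_mul_sum_antidiagonal hq n fun i _ =>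
    (-1) ^ i * q ^ triangle ((i : ℤ) - p - 1), altSum, mul_sum]
  refine sum_congr rfl fun x hx => ?_
  have hpow : q ^ x.2 * q ^ triangle (((x.1 + 1 : ℕ) : ℤ) - p - 1) =
      q ^ (n - p) * q ^ triangle ((x.1 : ℤ) - p - 1) := by
    have hx := mem_antidiagonal.1 hx
    have htriangle := triangle_add_one ((x.1 : ℤ) - p - 1)
    rw [← pow_add, ← pow_add,
      show ((x.1 + 1 : ℕ) : ℤ) - p - 1 = (x.1 : ℤ) - p - 1 + 1 by push_cast; ring]
    congr 1
    omega
  rw [pow_succ]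
  linear_combination -(invQFact q x.1 * invQFact q x.2 * (-1) ^ x.1) * hpow

theorem altSum_eq_zero (hq : |q| < 1) {n p : ℕ} (hp : p < n) : altSum q n p = 0 := by
  have eq_zero_of_mul : ∀ {n}, (1 - q ^ (n + 1)) * altSum q (n + 1) p = 0 →
      altSum q (n + 1) p = 0 := fun {n} h =>
    (mul_eq_zero.1 h).resolve_left (one_sub_pow_pos hq n.succ_ne_zero).ne'
  induction n, hp using Nat.le_induction with
  | base => exact eq_zero_of_mul (by rw [altSum_succ hq le_rfl, Nat.sub_self, pow_zero, sub_self,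
      zero_mul])
  | succ n hn ih => exact eq_zero_of_mul (by rw [altSum_succ hq (by omega), ih, mul_zero])

/-- The continuous `q`-Hermite polynomial `H_n(cos θ | q)`, divided by `(q; q)_n`. -/
noncomputable def qHermite (q θ : ℝ) (n : ℕ) : ℝ :=
  ∑ x ∈ antidiagonal n, invQFact q x.1 * invQFact q x.2 * Real.cos (((x.1 : ℝ) - x.2) * θ)

/-- The sequence `qHermite`, shifted by one: `0, h_0, h_1, …`. -/
noncomputable def qHermitePred (q θ : ℝ) : ℕ → ℝ
  | 0 => 0
  | n + 1 => qHermite q θ n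

theorem qHermite_zero (q θ : ℝ) : qHermite q θ 0 = 1 := by simp [qHermite]

theorem continuous_qHermite (q : ℝ) (n : ℕ) : Continuous fun θ => qHermite q θ n := by
  unfold qHermite
  fun_prop

theorem continuous_qHermitePred (q : ℝ) (n : ℕ) : Continuous fun θ => qHermitePred q θ n := by
  cases n with
  | zero => exact continuous_const
  | succ n => exact continuous_qHermite q n

theorem sum_antidiagonal_eq_qHermitePred (hq : |q| < 1) (θ : ℝ) (n : ℕ) :
    ∑ x ∈ antidiagonal n, (1 - q ^ x.2) * invQFact q x.2 *
      (invQFact q x.1 * Real.cos (((x.1 : ℝ) + 1 - x.2) * θ)) = qHermitePred q θ n := by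
  cases n with
  | zero => simp [qHermitePred]
  | succ n =>
    rw [sum_antidiagonal_one_sub_pow_snd hq n fun i j =>
      invQFact q i * Real.cos (((i : ℝ) + 1 - j) * θ), qHermitePred, qHermite]
    refine sum_congr rfl fun x _ => ?_
    rw [Nat.cast_succ, add_sub_add_right_eq_sub]
    ring

theorem two_cos_mul_qHermite (hq : |q| < 1) (θ : ℝ) (n : ℕ) :
    2 * Real.cos θ * qHermite q θ n =
      (1 - q ^ (n + 1)) * qHermite q θ (n + 1) + qHermitePred q θ n := by
  rw [qHermite, qHermite, one_sub_pow_mul_sum_antidiagonal hq n fun i j =>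
    Real.cos (((i : ℝ) - j) * θ), ← sum_antidiagonal_eq_qHermitePred hq, mul_sum,
    ← sum_add_distrib]
  refine sum_congr rfl fun x _ => ?_
  rw [show ((x.1 : ℝ) - (x.2 + 1 : ℕ)) * θ = ((x.1 : ℝ) - x.2) * θ - θ by push_cast; ring,
    show (((x.1 + 1 : ℕ) : ℝ) - x.2) * θ = ((x.1 : ℝ) - x.2) * θ + θ by push_cast; ring,
    show ((x.1 : ℝ) + 1 - x.2) * θ = ((x.1 : ℝ) - x.2) * θ + θ by ring, Real.cos_add,
    Real.cos_sub]
  ring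

end QFactorial

/-! ### Fourier coefficients of the finite products -/

section FourierCoeff

variable {q : ℝ}

/-- The Fourier coefficients of `(e^{2iθ}; q)_N (e^{-2iθ}; q)_N`, up to sign and normalization. -/
noncomputable def fourierCoeffAux (q : ℝ) (N : ℕ) (j : ℤ) : ℝ :=
  (q ^ triangle (j - 1) + q ^ triangle j) * (invQFactInt q (N + j) * invQFactInt q (N - j))

theorem fourierCoeffAux_neg (q : ℝ) (N : ℕ) (j : ℤ) :
    fourierCoeffAux q N (-j) = fourierCoeffAux q N j := by
  rw [fourierCoeffAux, triangle_neg, ← neg_add', triangle_neg, add_sub_cancel_right,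
    sub_neg_eq_add, ← sub_eq_add_neg, fourierCoeffAux]
  ring

theorem fourierCoeffAux_of_lt (q : ℝ) {N : ℕ} {j : ℤ} (h : (N : ℤ) < j) :
    fourierCoeffAux q N j = 0 := by
  rw [fourierCoeffAux, invQFactInt_of_neg q (sub_neg.2 h), mul_zero, mul_zero]

theorem fourierCoeffAux_zero (q : ℝ) (j : ℤ) : fourierCoeffAux q 0 j = if j = 0 then 2 else 0 := by
  split_ifs with h
  · subst h
    have htriangle : triangle (-1) = 0 := rfl
    simp [fourierCoeffAux, invQFactInt, htriangle]
    norm_num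
  · obtain ⟨k, rfl | rfl⟩ := Int.eq_nat_or_neg j
    · exact fourierCoeffAux_of_lt q (by omega)
    · rw [fourierCoeffAux_neg, fourierCoeffAux_of_lt q (by omega)]

theorem fourierCoeffAux_succ_zero (hq : |q| < 1) (N : ℕ) :
    (1 - q ^ (2 * N + 1)) * (1 - q ^ (N + 1)) * (1 + q ^ N) * fourierCoeffAux q (N + 1) 0 =
      (1 + q ^ (2 * N)) * fourierCoeffAux q N 0 +
        q ^ N * (fourierCoeffAux q N 1 + fourierCoeffAux q N (-1)) := by
  rw [fourierCoeffAux_neg]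
  have triangle_neg_one : triangle (-1) = 0 := rfl
  have triangle_one : triangle 1 = 1 := rfl
  have hN : (N : ℤ) + 1 = ((N + 1 : ℕ) : ℤ) := by push_cast; ring
  simp only [fourierCoeffAux, zero_sub, triangle_neg_one, triangle_zero, sub_self, triangle_one,
    add_zero, sub_zero, invQFactInt_natCast, hN, invQFactInt_sub_one hq,
    ← one_sub_pow_mul_invQFact hq N]
  ring

theorem fourierCoeffAux_succ_succ (hq : |q| < 1) (i d : ℕ) :
    (1 - q ^ (2 * (i + d) + 1)) * (1 - q ^ (i + d + 1)) * (1 + q ^ (i + d)) *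
        fourierCoeffAux q (i + d + 1) (i + 1) =
      (1 + q ^ (2 * (i + d))) * fourierCoeffAux q (i + d) (i + 1) +
        q ^ (i + d) * (fourierCoeffAux q (i + d) (i + 1 + 1) + fourierCoeffAux q (i + d) i) := by
  have triangle_zeroth : triangle i = triangle ((i : ℤ) - 1) + i := by
    have := triangle_add_one ((i : ℤ) - 1)
    rw [sub_add_cancel] at this
    omega
  have triangle_first : triangle ((i : ℤ) + 1) = triangle i + (i + 1) := by
    have := triangle_add_one i
    omega
  have triangle_second : triangle ((i : ℤ) + 1 + 1) = triangle ((i : ℤ) + 1) + (i + 1 + 1) := by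
    have := triangle_add_one (i + 1)
    omega
  simp only [fourierCoeffAux, add_sub_cancel_right]
  push_cast
  rw [show (i : ℤ) + d + 1 + (i + 1) = ((2 * i + d + 2 : ℕ) : ℤ) by push_cast; ring,
    show (i : ℤ) + d + 1 - (i + 1) = (d : ℤ) by ring,
    show (i : ℤ) + d + (i + 1) = ((2 * i + d + 1 : ℕ) : ℤ) by push_cast; ring,
    show (i : ℤ) + d - (i + 1) = (d : ℤ) - 1 by ring,
    show (i : ℤ) + d + (i + 1 + 1) = ((2 * i + d + 2 : ℕ) : ℤ) by push_cast; ring,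
    show (i : ℤ) + d - (i + 1 + 1) = (d : ℤ) - 1 - 1 by ring,
    show (i : ℤ) + d + i = ((2 * i + d : ℕ) : ℤ) by push_cast; ring,
    show (i : ℤ) + d - i = (d : ℤ) by ring]
  simp only [invQFactInt_natCast, invQFactInt_sub_one hq]
  rw [← one_sub_pow_mul_invQFact hq (2 * i + d), ← one_sub_pow_mul_invQFact hq (2 * i + d + 1),
    triangle_second, triangle_first, triangle_zeroth]
  linear_combination (exp := 1) -(q ^ (i + d) * invQFact q (2 * i + d + 2) *
    (q ^ (triangle ((i : ℤ) - 1) + 2 * i) + q ^ (triangle ((i : ℤ) - 1) + 3 * i + 2))) *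
      mul_invQFactInt_sub_two hq d

theorem fourierCoeffAux_succ_natCast (hq : |q| < 1) (N j : ℕ) :
    (1 - q ^ (2 * N + 1)) * (1 - q ^ (N + 1)) * (1 + q ^ N) * fourierCoeffAux q (N + 1) j =
      (1 + q ^ (2 * N)) * fourierCoeffAux q N j +
        q ^ N * (fourierCoeffAux q N (j + 1) + fourierCoeffAux q N (j - 1)) := by
  rcases lt_or_ge (N + 1) j with hNj | hjN
  · rw [fourierCoeffAux_of_lt q (by push_cast; omega), fourierCoeffAux_of_lt q (by omega),
      fourierCoeffAux_of_lt q (by omega), fourierCoeffAux_of_lt q (by omega)]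
    ring
  obtain _ | i := j
  · simpa using fourierCoeffAux_succ_zero hq N
  · obtain ⟨d, rfl⟩ := Nat.exists_eq_add_of_le (Nat.le_of_succ_le_succ hjN)
    simpa using fourierCoeffAux_succ_succ hq i d

theorem fourierCoeffAux_succ (hq : |q| < 1) (N : ℕ) (j : ℤ) :
    (1 - q ^ (2 * N + 1)) * (1 - q ^ (N + 1)) * (1 + q ^ N) * fourierCoeffAux q (N + 1) j =
      (1 + q ^ (2 * N)) * fourierCoeffAux q N j +
        q ^ N * (fourierCoeffAux q N (j + 1) + fourierCoeffAux q N (j - 1)) := by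
  obtain ⟨k, rfl | rfl⟩ := Int.eq_nat_or_neg j
  · exact fourierCoeffAux_succ_natCast hq N k
  · rw [show -(k : ℤ) + 1 = -(k - 1) by ring, show -(k : ℤ) - 1 = -(k + 1) by ring]
    simp only [fourierCoeffAux_neg]
    rw [fourierCoeffAux_succ_natCast hq N k]
    ring

end FourierCoeff

open MeasureTheory Filter Topology

/-! ### Infinite products -/

section QProd

variable {q c s : ℝ}

/-- The infinite product `(s z; q)_∞ (s / z; q)_∞`, where `c = (z + 1 / z) / 2`. -/
noncomputable def qProd (q c s : ℝ) : ℝ := ∏' k : ℕ, (1 - 2 * c * (s * q ^ k) + (s * q ^ k) ^ 2)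

/-- The partial products of `qProd`. -/
def qProdFin (q c s : ℝ) (N : ℕ) : ℝ :=
  ∏ k ∈ range N, (1 - 2 * c * (s * q ^ k) + (s * q ^ k) ^ 2)

theorem factor_nonneg (hc : |c| ≤ 1) (t : ℝ) : 0 ≤ 1 - 2 * c * t + t ^ 2 := by
  nlinarith [sq_nonneg (t - c), (sq_le_one_iff_abs_le_one c).2 hc]

theorem abs_factor_sub_one_le (hc : |c| ≤ 1) {t : ℝ} (ht : |t| ≤ 1) :
    |-(2 * c * t) + t ^ 2| ≤ 3 * |t| := by
  calc |-(2 * c * t) + t ^ 2| ≤ |-(2 * c * t)| + |t ^ 2| := abs_add_le _ _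
    _ = 2 * |c| * |t| + |t| * |t| := by rw [abs_neg, abs_mul, abs_mul, abs_two, abs_pow, sq]
    _ ≤ 2 * 1 * |t| + 1 * |t| := by gcongr
    _ = 3 * |t| := by ring

theorem abs_mul_pow_le (hs : |s| ≤ 1) (k : ℕ) : |s * q ^ k| ≤ |q| ^ k := by
  rw [abs_mul, abs_pow]
  exact mul_le_of_le_one_left (by positivity) hs

theorem abs_mul_pow_le_one (hq : |q| < 1) (hs : |s| ≤ 1) (k : ℕ) : |s * q ^ k| ≤ 1 :=
  (abs_mul_pow_le hs k).trans (pow_le_one₀ (abs_nonneg q) hq.le)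

theorem abs_mul_lt_one (hq : |q| < 1) (hs : |s| ≤ 1) : |s * q| < 1 := by
  rw [abs_mul]
  exact (mul_le_of_le_one_left (abs_nonneg q) hs).trans_lt hq

theorem hasProd_qProd (hq : |q| < 1) (hc : |c| ≤ 1) (hs : |s| ≤ 1) :
    HasProd (fun k : ℕ => 1 - 2 * c * (s * q ^ k) + (s * q ^ k) ^ 2) (qProd q c s) := by
  have hsummable : Summable fun k : ℕ => ‖-(2 * c * (s * q ^ k)) + (s * q ^ k) ^ 2‖ :=
    .of_nonneg_of_le (fun _ => norm_nonneg _)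
      (fun k => (abs_factor_sub_one_le hc (abs_mul_pow_le_one hq hs k)).trans
        (mul_le_mul_of_nonneg_left (abs_mul_pow_le hs k) zero_le_three))
      ((summable_geometric_of_lt_one (abs_nonneg q) hq).mul_left 3)
  have hmultipliable := multipliable_one_add_of_summable hsummable
  simp only [← add_assoc, ← sub_eq_add_neg] at hmultipliable
  exact hmultipliable.hasProd

theorem tendsto_qProdFin (hq : |q| < 1) (hc : |c| ≤ 1) (hs : |s| ≤ 1) :
    Tendsto (qProdFin q c s) atTop (𝓝 (qProd q c s)) :=
  (hasProd_qProd hq hc hs).tendsto_prod_nat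

theorem qProdFin_nonneg (hc : |c| ≤ 1) (s : ℝ) (N : ℕ) : 0 ≤ qProdFin q c s N :=
  prod_nonneg fun _ _ => factor_nonneg hc _

theorem qProdFin_le (hq : |q| < 1) (hc : |c| ≤ 1) (hs : |s| ≤ 1) (N : ℕ) :
    qProdFin q c s N ≤ Real.exp (3 * (1 - |q|)⁻¹) := by
  calc qProdFin q c s N ≤ ∏ k ∈ range N, Real.exp (3 * |q| ^ k) := by
        refine prod_le_prod (fun _ _ => factor_nonneg hc _) fun k _ => ?_
        have hfactor := le_of_abs_le (abs_factor_sub_one_le hc (abs_mul_pow_le_one hq hs k))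
        linarith [abs_mul_pow_le (q := q) hs k, Real.add_one_le_exp (3 * |q| ^ k)]
    _ = Real.exp (3 * ∑ k ∈ range N, |q| ^ k) := by rw [← Real.exp_sum, mul_sum]
    _ ≤ Real.exp (3 * (1 - |q|)⁻¹) := by
        gcongr
        rw [← tsum_geometric_of_lt_one (abs_nonneg q) hq]
        exact (summable_geometric_of_lt_one (abs_nonneg q) hq).sum_le_tsum _
          fun _ _ => by positivity

theorem qProd_nonneg (hq : |q| < 1) (hc : |c| ≤ 1) (hs : |s| ≤ 1) : 0 ≤ qProd q c s :=
  ge_of_tendsto' (tendsto_qProdFin hq hc hs) fun N => qProdFin_nonneg hc s N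

theorem qProd_le (hq : |q| < 1) (hc : |c| ≤ 1) (hs : |s| ≤ 1) :
    qProd q c s ≤ Real.exp (3 * (1 - |q|)⁻¹) :=
  le_of_tendsto' (tendsto_qProdFin hq hc hs) fun N => qProdFin_le hq hc hs N

theorem qProdFin_succ (q c s : ℝ) (N : ℕ) :
    qProdFin q c s (N + 1) =
      qProdFin q c s N * (1 - 2 * c * (s * q ^ N) + (s * q ^ N) ^ 2) :=
  prod_range_succ _ _

theorem qProdFin_succ' (q c s : ℝ) (N : ℕ) :
    qProdFin q c s (N + 1) = (1 - 2 * c * s + s ^ 2) * qProdFin q c (s * q) N := by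
  rw [qProdFin, prod_range_succ', mul_comm, pow_zero, mul_one, qProdFin]
  simp only [pow_succ', mul_assoc]

theorem qProd_eq_mul (hq : |q| < 1) (hc : |c| ≤ 1) (hs : |s| ≤ 1) :
    qProd q c s = (1 - 2 * c * s + s ^ 2) * qProd q c (s * q) := by
  have hshift := (tendsto_add_atTop_iff_nat 1).2 (tendsto_qProdFin hq hc hs)
  simp only [qProdFin_succ'] at hshift
  exact tendsto_nhds_unique hshift
    ((tendsto_qProdFin hq hc (abs_mul_lt_one hq hs).le).const_mul (1 - 2 * c * s + s ^ 2))

theorem continuous_qProdFin (q s : ℝ) (N : ℕ) : Continuous fun c => qProdFin q c s N := by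
  unfold qProdFin
  fun_prop

theorem measurable_qProd_cos (hq : |q| < 1) (hs : |s| ≤ 1) (k : ℝ) :
    Measurable fun θ => qProd q (Real.cos (k * θ)) s :=
  measurable_of_tendsto_metrizable
    (fun N => ((continuous_qProdFin q s N).comp (by fun_prop)).measurable)
    (tendsto_pi_nhds.2 fun _ => tendsto_qProdFin hq (Real.abs_cos_le_one _) hs)

end QProd

section Limits

variable {q : ℝ}

theorem summable_norm_neg_mul_pow (hq : |q| < 1) (a : ℝ) :
    Summable fun k : ℕ => ‖-(a * q ^ k)‖ := by
  simp only [norm_neg, norm_mul, norm_pow]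
  exact (summable_geometric_of_lt_one (norm_nonneg q) hq).mul_left _

theorem tendsto_qFact (hq : |q| < 1) : Tendsto (qFact q) atTop (𝓝 (qPochInf q q)) := by
  have hprod :=
    (multipliable_one_add_of_summable (summable_norm_neg_mul_pow hq q)).hasProd.tendsto_prod_nat
  simp only [← sub_eq_add_neg, ← pow_succ'] at hprod
  simp only [qPochInf, ← pow_succ']
  exact hprod

theorem qPochInf_ne_zero (hq : |q| < 1) : qPochInf q q ≠ 0 := by
  have hprod := tprod_one_add_ne_zero_of_summable (f := fun k : ℕ => -(q * q ^ k))
    (fun k => by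
      rw [← sub_eq_add_neg, ← pow_succ']
      exact (one_sub_pow_pos hq k.succ_ne_zero).ne') (summable_norm_neg_mul_pow hq q)
  simpa only [qPochInf, ← sub_eq_add_neg] using hprod

theorem tendsto_invQFact (hq : |q| < 1) : Tendsto (invQFact q) atTop (𝓝 (qPochInf q q)⁻¹) :=
  (tendsto_qFact hq).inv₀ (qPochInf_ne_zero hq)

theorem tendsto_invQFactInt_add (hq : |q| < 1) (i : ℤ) :
    Tendsto (fun N : ℕ => invQFactInt q (N + i)) atTop (𝓝 (qPochInf q q)⁻¹) := by
  have hindex : Tendsto (fun N : ℕ => ((N : ℤ) + i).toNat) atTop atTop := by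
    refine tendsto_atTop.2 fun b => ?_
    filter_upwards [eventually_ge_atTop (b + i.natAbs)] with N hN
    omega
  refine ((tendsto_invQFact hq).comp hindex).congr' ?_
  filter_upwards [eventually_ge_atTop i.natAbs] with N hN
  exact (if_pos (by omega)).symm

theorem exists_invQFact_le (hq : |q| < 1) : ∃ K, ∀ n, invQFact q n ≤ K := by
  obtain ⟨K, hK⟩ := (tendsto_invQFact hq).bddAbove_range
  exact ⟨K, fun n => hK ⟨n, rfl⟩⟩

end Limits

/-! ### Integration over the half circle -/

/-- Lebesgue measure on the interval `(0, π)`, over which the angle `θ` of a point `cos θ` of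
`(-1, 1)` ranges. -/
noncomputable def arc : Measure ℝ := volume.restrict (Set.Ioo 0 Real.pi)

instance : IsFiniteMeasure arc := ⟨by simp [arc]⟩

theorem ae_arc_of_forall {p : ℝ → Prop} (h : ∀ θ ∈ Set.Ioo 0 Real.pi, p θ) : ∀ᵐ θ ∂arc, p θ :=
  (ae_restrict_iff' measurableSet_Ioo).2 (ae_of_all _ h)

theorem integrable_arc_of_continuous {f : ℝ → ℝ} (hf : Continuous f) : Integrable f arc :=
  hf.integrableOn_Icc.mono_set Set.Ioo_subset_Icc_self

theorem integral_arc_cos (l : ℤ) :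
    ∫ θ, Real.cos (l * θ) ∂arc = if l = 0 then Real.pi else 0 := by
  rw [arc, ← integral_Ioc_eq_integral_Ioo, ← intervalIntegral.integral_of_le Real.pi_pos.le]
  split_ifs with hl
  · simp [hl]
  · rw [intervalIntegral.integral_comp_mul_left _ (Int.cast_ne_zero.2 hl), integral_cos]
    simp [Real.sin_int_mul_pi]

section FourierIntegrals

variable {q : ℝ}

theorem integral_qProdFin_succ (q : ℝ) (N : ℕ) (l : ℤ) :
    ∫ θ, qProdFin q (Real.cos (2 * θ)) 1 (N + 1) * Real.cos (l * θ) ∂arc =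
      (1 + q ^ (2 * N)) * ∫ θ, qProdFin q (Real.cos (2 * θ)) 1 N * Real.cos (l * θ) ∂arc -
        q ^ N * (∫ θ, qProdFin q (Real.cos (2 * θ)) 1 N * Real.cos ((l + 2 : ℤ) * θ) ∂arc +
          ∫ θ, qProdFin q (Real.cos (2 * θ)) 1 N * Real.cos ((l - 2 : ℤ) * θ) ∂arc) := by
  have hint : ∀ m : ℤ, Integrable (fun θ => qProdFin q (Real.cos (2 * θ)) 1 N *
      Real.cos (m * θ)) arc := fun m => integrable_arc_of_continuous
    (((continuous_qProdFin q 1 N).comp (by fun_prop)).mul (by fun_prop))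
  rw [← integral_add (hint _) (hint _), ← integral_const_mul, ← integral_const_mul,
    ← integral_sub ((hint _).const_mul _) (((hint _).fun_add (hint _)).const_mul _)]
  refine integral_congr_ae (ae_of_all _ fun θ => ?_)
  simp only [qProdFin_succ, Int.cast_add, Int.cast_sub, Int.cast_ofNat, add_mul, sub_mul,
    Real.cos_add, Real.cos_sub]
  ring

/-- The normalization of the Fourier coefficients of the finite products, namely
`(q; q)_{2N} / (1 + q^N)`. -/
noncomputable def fourierConst (q : ℝ) (N : ℕ) : ℝ := qFact q (2 * N) / (1 + q ^ N)

theorem fourierConst_succ (hq : |q| < 1) (N : ℕ) : fourierConst q (N + 1) =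
    fourierConst q N * ((1 - q ^ (2 * N + 1)) * (1 - q ^ (N + 1)) * (1 + q ^ N)) := by
  have hN := (one_add_pow_pos hq N).ne'
  have hN_succ := (one_add_pow_pos hq (N + 1)).ne'
  rw [fourierConst, fourierConst, show 2 * (N + 1) = 2 * N + 1 + 1 by ring, qFact_succ, qFact_succ,
    div_eq_iff hN_succ]
  field_simp
  ring

theorem tendsto_fourierConst (hq : |q| < 1) :
    Tendsto (fourierConst q) atTop (𝓝 (qPochInf q q)) := by
  have hnum : Tendsto (fun N => qFact q (2 * N)) atTop (𝓝 (qPochInf q q)) :=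
    (tendsto_qFact hq).comp (tendsto_id.const_mul_atTop' two_pos)
  have hden : Tendsto (fun N => 1 + q ^ N) atTop (𝓝 1) := by
    simpa using (tendsto_pow_atTop_nhds_zero_of_abs_lt_one hq).const_add 1
  rw [← div_one (qPochInf q q)]
  exact hnum.div hden one_ne_zero

theorem integral_qProdFin_odd (q : ℝ) (N : ℕ) (j : ℤ) :
    ∫ θ, qProdFin q (Real.cos (2 * θ)) 1 N * Real.cos ((2 * j + 1 : ℤ) * θ) ∂arc = 0 := by
  induction N generalizing j with
  | zero =>
    simp only [qProdFin, range_zero, prod_empty, one_mul]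
    rw [integral_arc_cos, if_neg (by omega)]
  | succ N ih =>
    rw [integral_qProdFin_succ, ih, show 2 * j + 1 + 2 = 2 * (j + 1) + 1 by ring, ih,
      show 2 * j + 1 - 2 = 2 * (j - 1) + 1 by ring, ih, mul_zero, add_zero, mul_zero, sub_zero]

theorem integral_qProdFin_even (hq : |q| < 1) (N : ℕ) (j : ℤ) :
    ∫ θ, qProdFin q (Real.cos (2 * θ)) 1 N * Real.cos ((2 * j : ℤ) * θ) ∂arc =
      Real.pi * (-1) ^ j * (fourierConst q N * fourierCoeffAux q N j) := by
  induction N generalizing j with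
  | zero =>
    simp only [qProdFin, range_zero, prod_empty, one_mul]
    rw [integral_arc_cos, fourierCoeffAux_zero, fourierConst, mul_zero, qFact_zero, pow_zero]
    rcases eq_or_ne j 0 with rfl | hj
    · norm_num
    · rw [if_neg (mul_ne_zero two_ne_zero hj), if_neg hj, mul_zero, mul_zero]
  | succ N ih =>
    rw [integral_qProdFin_succ, ih, show 2 * j + 2 = 2 * (j + 1) by ring, ih,
      show 2 * j - 2 = 2 * (j - 1) by ring, ih, fourierConst_succ hq,
      zpow_add_one₀ (by norm_num), zpow_sub_one₀ (by norm_num), inv_neg_one]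
    linear_combination -(Real.pi * (-1) ^ j * fourierConst q N) * fourierCoeffAux_succ hq N j

/-- The weight function `(e^{2iθ}; q)_∞ (e^{-2iθ}; q)_∞` of the continuous `q`-Hermite
polynomials. -/
noncomputable def hermiteWeight (q θ : ℝ) : ℝ := qProd q (Real.cos (2 * θ)) 1

theorem measurable_hermiteWeight (hq : |q| < 1) : Measurable (hermiteWeight q) :=
  measurable_qProd_cos hq abs_one.le 2

theorem abs_hermiteWeight_le (hq : |q| < 1) (θ : ℝ) :
    |hermiteWeight q θ| ≤ Real.exp (3 * (1 - |q|)⁻¹) := by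
  rw [hermiteWeight, abs_of_nonneg (qProd_nonneg hq (Real.abs_cos_le_one _) abs_one.le)]
  exact qProd_le hq (Real.abs_cos_le_one _) abs_one.le

theorem integrable_hermiteWeight_mul (hq : |q| < 1) {f : ℝ → ℝ} (hf : Continuous f) :
    Integrable (fun θ => hermiteWeight q θ * f θ) arc :=
  (integrable_arc_of_continuous hf).bdd_mul (measurable_hermiteWeight hq).aestronglyMeasurable
    (ae_of_all _ (abs_hermiteWeight_le hq))

theorem tendsto_integral_qProdFin (hq : |q| < 1) (l : ℤ) :
    Tendsto (fun N => ∫ θ, qProdFin q (Real.cos (2 * θ)) 1 N * Real.cos (l * θ) ∂arc) atTop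
      (𝓝 (∫ θ, hermiteWeight q θ * Real.cos (l * θ) ∂arc)) := by
  refine tendsto_integral_of_dominated_convergence (fun _ => Real.exp (3 * (1 - |q|)⁻¹))
    (fun N => (((continuous_qProdFin q 1 N).comp (by fun_prop)).mul
      (by fun_prop)).aestronglyMeasurable) (integrable_const _) (fun N => ae_of_all _ fun θ => ?_)
    (ae_of_all _ fun θ => (tendsto_qProdFin hq (Real.abs_cos_le_one _) abs_one.le).mul_const _)
  have hnonneg := qProdFin_nonneg (q := q) (Real.abs_cos_le_one (2 * θ)) 1 N
  rw [norm_mul, Real.norm_of_nonneg hnonneg]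
  exact (mul_le_of_le_one_right hnonneg (Real.abs_cos_le_one _)).trans
    (qProdFin_le hq (Real.abs_cos_le_one _) abs_one.le N)

theorem integral_hermiteWeight_odd (hq : |q| < 1) (j : ℤ) :
    ∫ θ, hermiteWeight q θ * Real.cos ((2 * j + 1 : ℤ) * θ) ∂arc = 0 := by
  have hlim := tendsto_integral_qProdFin hq (2 * j + 1)
  simp only [integral_qProdFin_odd] at hlim
  exact tendsto_nhds_unique hlim tendsto_const_nhds

theorem integral_hermiteWeight_even (hq : |q| < 1) (j : ℤ) :
    ∫ θ, hermiteWeight q θ * Real.cos ((2 * j : ℤ) * θ) ∂arc =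
      Real.pi / qPochInf q q * ((-1) ^ j * (q ^ triangle (j - 1) + q ^ triangle j)) := by
  have hlim := tendsto_integral_qProdFin hq (2 * j)
  simp only [integral_qProdFin_even hq, fourierCoeffAux] at hlim
  have hne := qPochInf_ne_zero hq
  rw [tendsto_nhds_unique hlim <| .const_mul _ <| (tendsto_fourierConst hq).mul <| .const_mul _ <|
    (tendsto_invQFactInt_add hq j).mul (tendsto_invQFactInt_add hq (-j))]
  generalize (-1 : ℝ) ^ j = ε
  field_simp

end FourierIntegrals

/-! ### Orthogonality of the continuous `q`-Hermite polynomials -/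

section HermiteOrthogonality

variable {q : ℝ}

theorem integral_hermiteWeight (hq : |q| < 1) :
    ∫ θ, hermiteWeight q θ ∂arc = 2 * Real.pi / qPochInf q q := by
  have triangle_neg_one : triangle (-1) = 0 := rfl
  have hzero := integral_hermiteWeight_even hq 0
  simp only [mul_zero, Int.cast_zero, zero_mul, Real.cos_zero, mul_one, zpow_zero, zero_sub,
    triangle_neg_one, triangle_zero, pow_zero, one_mul] at hzero
  rw [hzero]
  ring

theorem integral_hermiteWeight_mul_qHermite_eq_sum (hq : |q| < 1) (n : ℕ) :
    ∫ θ, hermiteWeight q θ * qHermite q θ n ∂arc =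
      ∑ x ∈ antidiagonal n, invQFact q x.1 * invQFact q x.2 *
        ∫ θ, hermiteWeight q θ * Real.cos (((x.1 : ℤ) - x.2 : ℤ) * θ) ∂arc := by
  simp only [← integral_const_mul]
  rw [← integral_finsetSum _ fun x _ =>
    (integrable_hermiteWeight_mul hq (by fun_prop)).const_mul _]
  refine integral_congr_ae (ae_of_all _ fun θ => ?_)
  simp only [qHermite, mul_sum, Int.cast_sub, Int.cast_natCast]
  exact sum_congr rfl fun x _ => by ring

theorem integral_hermiteWeight_mul_qHermite_odd (hq : |q| < 1) (p : ℕ) :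
    ∫ θ, hermiteWeight q θ * qHermite q θ (2 * p + 1) ∂arc = 0 := by
  rw [integral_hermiteWeight_mul_qHermite_eq_sum hq]
  refine sum_eq_zero fun x hx => ?_
  have hx := mem_antidiagonal.1 hx
  rw [show (x.1 : ℤ) - x.2 = 2 * (x.1 - p - 1) + 1 by omega, integral_hermiteWeight_odd hq,
    mul_zero]

theorem integral_hermiteWeight_mul_qHermite_even (hq : |q| < 1) (p : ℕ) :
    ∫ θ, hermiteWeight q θ * qHermite q θ (2 * (p + 1)) ∂arc = 0 := by
  calc ∫ θ, hermiteWeight q θ * qHermite q θ (2 * (p + 1)) ∂arc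
      = Real.pi / qPochInf q q * (-1) ^ (p + 1) *
          (altSum q (2 * (p + 1)) (p + 1) + altSum q (2 * (p + 1)) p) := by
        rw [integral_hermiteWeight_mul_qHermite_eq_sum hq, altSum, altSum, ← sum_add_distrib,
          mul_sum]
        refine sum_congr rfl fun x hx => ?_
        have hx := mem_antidiagonal.1 hx
        have hsign : (-1 : ℝ) ^ ((x.1 : ℤ) - p - 1) = (-1) ^ (p + 1) * (-1) ^ x.1 := by
          rw [sub_sub, zpow_sub₀ (by norm_num), div_eq_mul_inv, ← inv_zpow, mul_comm, inv_neg_one]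
          norm_cast
        rw [show (x.1 : ℤ) - x.2 = 2 * ((x.1 : ℤ) - p - 1) by omega,
          integral_hermiteWeight_even hq, hsign, Nat.cast_succ, ← sub_sub]
        ring
    _ = 0 := by
        rw [altSum_eq_zero hq (by omega), altSum_eq_zero hq (by omega), add_zero, mul_zero]

theorem integral_hermiteWeight_mul_qHermite (hq : |q| < 1) {n : ℕ} (hn : n ≠ 0) :
    ∫ θ, hermiteWeight q θ * qHermite q θ n ∂arc = 0 := by
  obtain ⟨p, rfl | rfl⟩ := Nat.even_or_odd' n
  · obtain ⟨r, rfl⟩ := Nat.exists_eq_succ_of_ne_zero (right_ne_zero_of_mul hn)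
    exact integral_hermiteWeight_mul_qHermite_even hq r
  · exact integral_hermiteWeight_mul_qHermite_odd hq p

theorem integral_qHermite_exchange (hq : |q| < 1) (m n : ℕ) :
    (1 - q ^ (m + 1)) * ∫ θ, hermiteWeight q θ * (qHermite q θ (m + 1) * qHermite q θ n) ∂arc +
        ∫ θ, hermiteWeight q θ * (qHermitePred q θ m * qHermite q θ n) ∂arc =
      (1 - q ^ (n + 1)) * ∫ θ, hermiteWeight q θ * (qHermite q θ m * qHermite q θ (n + 1)) ∂arc +
        ∫ θ, hermiteWeight q θ * (qHermite q θ m * qHermitePred q θ n) ∂arc := by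
  have hcont := continuous_qHermite q
  have hcont_pred := continuous_qHermitePred q
  have hint : ∀ {f g : ℝ → ℝ}, Continuous f → Continuous g →
      Integrable (fun θ => hermiteWeight q θ * (f θ * g θ)) arc := fun hf hg =>
    integrable_hermiteWeight_mul hq (hf.mul hg)
  rw [← integral_const_mul, ← integral_const_mul,
    ← integral_add ((hint (hcont _) (hcont _)).const_mul _) (hint (hcont_pred _) (hcont _)),
    ← integral_add ((hint (hcont _) (hcont _)).const_mul _) (hint (hcont _) (hcont_pred _))]
  refine integral_congr_ae (ae_of_all _ fun θ => ?_)
  linear_combination hermiteWeight q θ * (qHermite q θ m * two_cos_mul_qHermite hq θ n -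
    qHermite q θ n * two_cos_mul_qHermite hq θ m)

theorem integral_qHermite_mul_qHermite (hq : |q| < 1) (m n : ℕ) :
    ∫ θ, hermiteWeight q θ * (qHermite q θ m * qHermite q θ n) ∂arc =
      if m = n then 2 * Real.pi / qPochInf q q * invQFact q n else 0 := by
  induction m using Nat.strong_induction_on generalizing n with
  | _ m ih =>
  obtain _ | m := m
  · simp only [qHermite_zero, one_mul]
    split_ifs with hn
    · simp [← hn, qHermite_zero, integral_hermiteWeight hq]
    · exact integral_hermiteWeight_mul_qHermite hq (Ne.symm hn)
  have hleft : ∫ θ, hermiteWeight q θ * (qHermitePred q θ m * qHermite q θ n) ∂arc =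
      if m = n + 1 then 2 * Real.pi / qPochInf q q * invQFact q n else 0 := by
    obtain _ | k := m
    · simp [qHermitePred]
    · simpa [qHermitePred] using ih k (by omega) n
  have hright : ∫ θ, hermiteWeight q θ * (qHermite q θ m * qHermitePred q θ n) ∂arc =
      if m + 1 = n then 2 * Real.pi / qPochInf q q * invQFact q m else 0 := by
    obtain _ | k := n
    · simp [qHermitePred]
    · simp only [Nat.add_right_cancel_iff]
      exact (ih m (by omega) k).trans (ite_congr rfl (fun h => by rw [h]) fun _ => rfl)
  have hexchange := integral_qHermite_exchange hq m n
  rw [hleft, hright, ih m (by omega)] at hexchange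
  have hne : 1 - q ^ (m + 1) ≠ 0 := (one_sub_pow_pos hq m.succ_ne_zero).ne'
  refine mul_left_cancel₀ hne ?_
  obtain rfl | hpred := eq_or_ne m (n + 1)
  · rw [if_pos rfl, if_pos rfl, if_neg (by omega)] at hexchange
    rw [if_neg (by omega)]
    linear_combination hexchange + 2 * Real.pi / qPochInf q q * one_sub_pow_mul_invQFact hq n
  rw [if_neg hpred, if_neg hpred] at hexchange
  split_ifs at hexchange ⊢ with hsucc
  · subst hsucc
    linear_combination hexchange - 2 * Real.pi / qPochInf q q * one_sub_pow_mul_invQFact hq m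
  · linear_combination hexchange

end HermiteOrthogonality

/-! ### Generating functions -/

section PowerSeries

variable {c : ℕ → ℝ} {K q r s : ℝ}

theorem summable_linear_mul_pow (hr : |r| < 1) (K : ℝ) :
    Summable fun n : ℕ => K * ((n : ℝ) + 1) * r ^ n := by
  have hgeometric : Summable fun n : ℕ => r ^ n := summable_geometric_of_abs_lt_one hr
  have hlinear := summable_pow_mul_geometric_of_norm_lt_one (R := ℝ) 1 hr
  exact ((hlinear.add hgeometric).mul_left K).congr fun n => by ring

theorem norm_mul_pow_le (hc : ∀ n, |c n| ≤ K * ((n : ℝ) + 1)) (hs : |s| ≤ r) (n : ℕ) :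
    ‖c n * s ^ n‖ ≤ K * ((n : ℝ) + 1) * r ^ n := by
  rw [norm_mul, norm_pow]
  exact mul_le_mul (hc n) (pow_le_pow_left₀ (norm_nonneg s) hs n) (by positivity)
    ((abs_nonneg _).trans (hc n))

theorem summable_mul_pow (hc : ∀ n, |c n| ≤ K * ((n : ℝ) + 1)) (hs : |s| < 1) :
    Summable fun n => c n * s ^ n :=
  .of_norm_bounded (summable_linear_mul_pow (by rwa [abs_abs]) K) (norm_mul_pow_le hc le_rfl)

theorem continuousAt_tsum_mul_pow (hc : ∀ n, |c n| ≤ K * ((n : ℝ) + 1)) (hs : |s| < 1) :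
    ContinuousAt (fun s => ∑' n, c n * s ^ n) s := by
  obtain ⟨r, hsr, hr⟩ := exists_between hs
  have hr_abs : |r| < 1 := by rwa [abs_of_pos ((abs_nonneg s).trans_lt hsr)]
  have hcontOn : ContinuousOn (fun s => ∑' n, c n * s ^ n) {s | |s| ≤ r} :=
    continuousOn_tsum (fun n => by fun_prop) (summable_linear_mul_pow hr_abs K)
      fun n s hs => norm_mul_pow_le hc hs n
  exact hcontOn.continuousAt ((continuous_abs.tendsto s).eventually_le_const hsr)

theorem hasSum_one_sub_pow_mul (hq : |q| < 1) (hc : ∀ n, |c n| ≤ K * ((n : ℝ) + 1))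
    (hs : |s| < 1) :
    HasSum (fun n => (1 - q ^ (n + 1)) * c (n + 1) * s ^ (n + 1))
      (∑' n, c n * s ^ n - ∑' n, c n * (s * q) ^ n) := by
  have hdiff := (summable_mul_pow hc hs).hasSum.sub
    (summable_mul_pow hc (abs_mul_lt_one hq hs.le)).hasSum
  rw [← hasSum_nat_add_iff' 1] at hdiff
  simp only [range_one, sum_singleton, pow_zero, sub_self, sub_zero] at hdiff
  exact hdiff.congr_fun fun n => by ring

theorem tendsto_tsum_mul_pow_geometric (hq : |q| < 1) (hc : ∀ n, |c n| ≤ K * ((n : ℝ) + 1))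
    (s : ℝ) : Tendsto (fun N => ∑' n, c n * (s * q ^ N) ^ n) atTop (𝓝 (c 0)) := by
  have hgeometric : Tendsto (fun N => s * q ^ N) atTop (𝓝 0) := by
    simpa using (tendsto_pow_atTop_nhds_zero_of_abs_lt_one hq).const_mul s
  have hzero : ∑' n, c n * 0 ^ n = c 0 := by
    rw [tsum_eq_single 0 fun n hn => by simp [hn], pow_zero, mul_one]
  rw [← hzero]
  exact (continuousAt_tsum_mul_pow hc (by simp)).tendsto.comp hgeometric

end PowerSeries

section GeneratingFunction

variable {q s : ℝ}

theorem exists_qHermite_bound (hq : |q| < 1) :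
    ∃ K, ∀ θ n, |qHermite q θ n| ≤ K * ((n : ℝ) + 1) := by
  obtain ⟨K, hK⟩ := exists_invQFact_le hq
  refine ⟨K * K, fun θ n => ?_⟩
  calc |qHermite q θ n| ≤ ∑ x ∈ antidiagonal n,
        |invQFact q x.1 * invQFact q x.2 * Real.cos (((x.1 : ℝ) - x.2) * θ)| :=
        abs_sum_le_sum_abs _ _
    _ ≤ ∑ _x ∈ antidiagonal n, K * K := by
        refine sum_le_sum fun x _ => ?_
        have hfst := (invQFact_pos hq x.1).le
        have hsnd := (invQFact_pos hq x.2).le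
        rw [abs_mul, abs_of_nonneg (mul_nonneg hfst hsnd)]
        exact (mul_le_of_le_one_right (mul_nonneg hfst hsnd) (Real.abs_cos_le_one _)).trans
          (mul_le_mul (hK _) (hK _) hsnd (hfst.trans (hK _)))
    _ = K * K * ((n : ℝ) + 1) := by
        rw [sum_const, Nat.card_antidiagonal, nsmul_eq_mul, Nat.cast_succ, mul_comm]

/-- The generating function of the continuous `q`-Hermite polynomials. -/
noncomputable def qHermiteGen (q θ s : ℝ) : ℝ := ∑' n, qHermite q θ n * s ^ n

theorem exists_qHermiteGen_bound (hq : |q| < 1) {r : ℝ} (hr : |r| < 1) :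
    ∃ K, ∀ θ s, |s| ≤ r → |qHermiteGen q θ s| ≤ K := by
  obtain ⟨K, hK⟩ := exists_qHermite_bound hq
  exact ⟨_, fun θ s hs => tsum_of_norm_bounded (summable_linear_mul_pow hr K).hasSum
    (norm_mul_pow_le (hK θ) hs)⟩

theorem continuous_qHermiteGen (hq : |q| < 1) (hs : |s| < 1) :
    Continuous fun θ => qHermiteGen q θ s := by
  obtain ⟨K, hK⟩ := exists_qHermite_bound hq
  exact continuous_tsum (fun n => (continuous_qHermite q n).mul continuous_const)
    (summable_linear_mul_pow (by rwa [abs_abs]) K) fun n θ => norm_mul_pow_le (hK θ) le_rfl n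

theorem continuousAt_qHermiteGen (hq : |q| < 1) (θ : ℝ) (hs : |s| < 1) :
    ContinuousAt (qHermiteGen q θ) s := by
  obtain ⟨K, hK⟩ := exists_qHermite_bound hq
  exact continuousAt_tsum_mul_pow (hK θ) hs

theorem hasSum_qHermitePred (hq : |q| < 1) (θ : ℝ) (hs : |s| < 1) :
    HasSum (fun n => qHermitePred q θ n * s ^ n) (s * qHermiteGen q θ s) := by
  obtain ⟨K, hK⟩ := exists_qHermite_bound hq
  rw [← hasSum_nat_add_iff' 1]
  simp only [range_one, sum_singleton, qHermitePred, zero_mul, sub_zero]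
  exact ((summable_mul_pow (hK θ) hs).hasSum.mul_left s).congr_fun fun n => by ring

theorem factor_mul_qHermiteGen (hq : |q| < 1) (θ : ℝ) (hs : |s| < 1) :
    (1 - 2 * Real.cos θ * s + s ^ 2) * qHermiteGen q θ s = qHermiteGen q θ (s * q) := by
  obtain ⟨K, hK⟩ := exists_qHermite_bound hq
  have hrec : HasSum (fun n => (1 - q ^ (n + 1)) * qHermite q θ (n + 1) * s ^ (n + 1))
      (2 * Real.cos θ * s * qHermiteGen q θ s - s * (s * qHermiteGen q θ s)) := by
    refine (((summable_mul_pow (hK θ) hs).hasSum.mul_left (2 * Real.cos θ * s)).sub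
      ((hasSum_qHermitePred hq θ hs).mul_left s)).congr_fun fun n => ?_
    linear_combination -(s ^ n * s) * two_cos_mul_qHermite hq θ n
  have hshift := hrec.unique (hasSum_one_sub_pow_mul hq (hK θ) hs)
  rw [← qHermiteGen, ← qHermiteGen] at hshift
  linear_combination -hshift

theorem qProdFin_mul_qHermiteGen (hq : |q| < 1) (θ : ℝ) (hs : |s| < 1) (N : ℕ) :
    qProdFin q (Real.cos θ) s N * qHermiteGen q θ s = qHermiteGen q θ (s * q ^ N) := by
  induction N generalizing s with
  | zero => simp [qProdFin]
  | succ N ih =>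
    rw [qProdFin_succ', mul_right_comm, factor_mul_qHermiteGen hq θ hs, mul_comm,
      ih (abs_mul_lt_one hq hs.le), pow_succ', mul_assoc]

theorem qProd_mul_qHermiteGen (hq : |q| < 1) (θ : ℝ) (hs : |s| < 1) :
    qProd q (Real.cos θ) s * qHermiteGen q θ s = 1 := by
  obtain ⟨K, hK⟩ := exists_qHermite_bound hq
  have hprod :=
    (tendsto_qProdFin hq (Real.abs_cos_le_one θ) hs.le).mul_const (qHermiteGen q θ s)
  simp only [qProdFin_mul_qHermiteGen hq θ hs] at hprod
  rw [← qHermite_zero q θ]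
  exact tendsto_nhds_unique hprod (tendsto_tsum_mul_pow_geometric hq (hK θ) s)

theorem inv_qProd_eq_qHermiteGen (hq : |q| < 1) (θ : ℝ) (hs : |s| < 1) :
    (qProd q (Real.cos θ) s)⁻¹ = qHermiteGen q θ s :=
  inv_eq_of_mul_eq_one_right (qProd_mul_qHermiteGen hq θ hs)

theorem inv_qProd_eq_div (hq : |q| < 1) (θ : ℝ) (hs : |s| ≤ 1) :
    (qProd q (Real.cos θ) s)⁻¹ =
      qHermiteGen q θ (s * q) / (1 - 2 * Real.cos θ * s + s ^ 2) := by
  rw [qProd_eq_mul hq (Real.abs_cos_le_one θ) hs, mul_inv,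
    inv_qProd_eq_qHermiteGen hq θ (abs_mul_lt_one hq hs), div_eq_inv_mul]

theorem hasSum_integral_qHermiteGen (hq : |q| < 1) (hs : |s| < 1) {f : ℝ → ℝ}
    (hf : Continuous f) :
    HasSum (fun n => s ^ n * ∫ θ, hermiteWeight q θ * (f θ * qHermite q θ n) ∂arc)
      (∫ θ, hermiteWeight q θ * (f θ * qHermiteGen q θ s) ∂arc) := by
  obtain ⟨K, hK⟩ := exists_qHermite_bound hq
  have hint := integrable_hermiteWeight_mul hq hf
  simp only [← integral_const_mul]
  refine hasSum_integral_of_dominated_convergence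
    (fun n θ => ‖hermiteWeight q θ * f θ‖ * (K * ((n : ℝ) + 1) * |s| ^ n))
    (fun n => ((integrable_hermiteWeight_mul hq
      (hf.mul (continuous_qHermite q n))).const_mul _).aestronglyMeasurable)
    (fun n => ae_of_all _ fun θ => ?_)
    (ae_of_all _ fun θ => (summable_linear_mul_pow (by rwa [abs_abs]) K).mul_left _) ?_
    (ae_of_all _ fun θ => ?_)
  · rw [show s ^ n * (hermiteWeight q θ * (f θ * qHermite q θ n)) =
      hermiteWeight q θ * f θ * (qHermite q θ n * s ^ n) by ring, norm_mul]
    exact mul_le_mul_of_nonneg_left (norm_mul_pow_le (hK θ) le_rfl n) (norm_nonneg _)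
  · simp only [tsum_mul_left]
    exact hint.norm.mul_const _
  · rw [← mul_assoc]
    exact ((summable_mul_pow (hK θ) hs).hasSum.mul_left (hermiteWeight q θ * f θ)).congr_fun
      fun n => by ring

theorem integral_qHermite_mul_qHermiteGen (hq : |q| < 1) (hs : |s| < 1) (m : ℕ) :
    ∫ θ, hermiteWeight q θ * (qHermite q θ m * qHermiteGen q θ s) ∂arc =
      2 * Real.pi / qPochInf q q * invQFact q m * s ^ m := by
  refine (hasSum_integral_qHermiteGen hq hs (continuous_qHermite q m)).unique ?_
  simp only [integral_qHermite_mul_qHermite hq]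
  convert hasSum_ite_eq m (2 * Real.pi / qPochInf q q * invQFact q m * s ^ m) using 2 with n
  rcases eq_or_ne m n with rfl | hmn
  · rw [if_pos rfl, if_pos rfl, mul_comm]
  · rw [if_neg hmn, if_neg hmn.symm, mul_zero]

end GeneratingFunction

section EulerSeries

variable {q : ℝ}

/-- Euler's series `∑ x ^ n / (q; q)_n`. -/
noncomputable def eulerSeries (q x : ℝ) : ℝ := ∑' n, invQFact q n * x ^ n

theorem exists_abs_invQFact_le_linear (hq : |q| < 1) :
    ∃ K, ∀ n : ℕ, |invQFact q n| ≤ K * ((n : ℝ) + 1) := by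
  obtain ⟨K, hK⟩ := exists_invQFact_le hq
  refine ⟨K, fun n => ?_⟩
  have hpos := invQFact_pos hq n
  rw [abs_of_pos hpos]
  exact (hK n).trans (le_mul_of_one_le_right (hpos.le.trans (hK n)) (by simp))

theorem continuousAt_eulerSeries (hq : |q| < 1) {x : ℝ} (hx : |x| < 1) :
    ContinuousAt (eulerSeries q) x := by
  obtain ⟨K, hK⟩ := exists_abs_invQFact_le_linear hq
  exact continuousAt_tsum_mul_pow hK hx

theorem one_sub_mul_eulerSeries (hq : |q| < 1) {x : ℝ} (hx : |x| < 1) :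
    (1 - x) * eulerSeries q x = eulerSeries q (x * q) := by
  obtain ⟨K, hK⟩ := exists_abs_invQFact_le_linear hq
  have hrec : HasSum (fun n => (1 - q ^ (n + 1)) * invQFact q (n + 1) * x ^ (n + 1))
      (x * eulerSeries q x) := by
    refine ((summable_mul_pow hK hx).hasSum.mul_left x).congr_fun fun n => ?_
    rw [one_sub_pow_mul_invQFact hq]
    ring
  have hshift := hrec.unique (hasSum_one_sub_pow_mul hq hK hx)
  rw [← eulerSeries, ← eulerSeries] at hshift
  linear_combination -hshift

theorem qFact_mul_eulerSeries (hq : |q| < 1) (N : ℕ) :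
    qFact q N * eulerSeries q q = eulerSeries q (q * q ^ N) := by
  induction N with
  | zero => simp
  | succ N ih =>
    rw [qFact_succ, mul_right_comm, ih, mul_comm, ← pow_succ',
      one_sub_mul_eulerSeries hq (abs_pow_lt_one hq N.succ_ne_zero), ← pow_succ, pow_succ']

theorem eulerSeries_self (hq : |q| < 1) : eulerSeries q q = (qPochInf q q)⁻¹ := by
  obtain ⟨K, hK⟩ := exists_abs_invQFact_le_linear hq
  have hprod := (tendsto_qFact hq).mul_const (eulerSeries q q)
  simp only [qFact_mul_eulerSeries hq] at hprod
  refine eq_inv_of_mul_eq_one_right ?_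
  rw [← invQFact_zero q]
  exact tendsto_nhds_unique hprod (tendsto_tsum_mul_pow_geometric hq hK q)

theorem integral_qHermiteGen_mul_qHermiteGen (hq : |q| < 1) {a b : ℝ} (ha : |a| < 1)
    (hb : |b| < 1) :
    ∫ θ, hermiteWeight q θ * (qHermiteGen q θ a * qHermiteGen q θ b) ∂arc =
      2 * Real.pi / qPochInf q q * eulerSeries q (a * b) := by
  obtain ⟨K, hK⟩ := exists_abs_invQFact_le_linear hq
  refine (hasSum_integral_qHermiteGen hq hb (continuous_qHermiteGen hq ha)).unique ?_
  refine ((summable_mul_pow hK (abs_mul_lt_one hb ha.le)).hasSum.mul_left _).congr_fun fun n => ?_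
  simp only [mul_comm (qHermiteGen q _ a), integral_qHermite_mul_qHermiteGen hq ha, mul_pow]
  ring

end EulerSeries

/-! ### Al-Salam–Chihara polynomials -/

section AlSalamChiharaWeight

variable {q a b : ℝ}

/-- The weight function of the Al-Salam–Chihara polynomials with parameters `a` and `b`, as a
density on the arc. -/
noncomputable def ascWeight (q a b θ : ℝ) : ℝ :=
  hermiteWeight q θ * ((qProd q (Real.cos θ) a)⁻¹ * (qProd q (Real.cos θ) b)⁻¹)

theorem ascWeight_comm (q a b θ : ℝ) : ascWeight q a b θ = ascWeight q b a θ := by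
  rw [ascWeight, ascWeight, mul_comm (_)⁻¹]

/-- The left-hand side is the squared imaginary part of
`exp (iθ) (1 - a exp (-iθ)) (1 - b exp (-iθ))`, and the right-hand side is its squared modulus. -/
theorem sin_mul_one_sub_sq_le (θ a b : ℝ) :
    (Real.sin θ * (1 - a * b)) ^ 2 ≤
      (1 - 2 * Real.cos θ * a + a ^ 2) * (1 - 2 * Real.cos θ * b + b ^ 2) := by
  have hre : (1 - 2 * Real.cos θ * a + a ^ 2) * (1 - 2 * Real.cos θ * b + b ^ 2) -
      (Real.sin θ * (1 - a * b)) ^ 2 = ((1 + a * b) * Real.cos θ - (a + b)) ^ 2 := by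
    linear_combination -(1 - a * b) ^ 2 * Real.sin_sq_add_cos_sq θ
  exact sub_nonneg.1 (hre ▸ sq_nonneg _)

theorem factor_pos {θ : ℝ} (hθ : θ ∈ Set.Ioo 0 Real.pi) (s : ℝ) :
    0 < 1 - 2 * Real.cos θ * s + s ^ 2 := by
  have hle := sin_mul_one_sub_sq_le θ s 0
  simp only [mul_zero, sub_zero, mul_one, ne_eq, OfNat.ofNat_ne_zero, not_false_eq_true, zero_pow,
    add_zero] at hle
  exact (pow_pos (Real.sin_pos_of_mem_Ioo hθ) 2).trans_le hle

theorem hermiteWeight_eq (hq : |q| < 1) (θ : ℝ) :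
    hermiteWeight q θ = 4 * Real.sin θ ^ 2 * qProd q (Real.cos (2 * θ)) q := by
  rw [hermiteWeight, qProd_eq_mul hq (Real.abs_cos_le_one _) abs_one.le, one_mul,
    Real.cos_two_mul, Real.sin_sq]
  ring

theorem ascWeight_eq_div (hq : |q| < 1) (ha : |a| ≤ 1) (hb : |b| ≤ 1) (θ : ℝ) :
    ascWeight q a b θ = 4 * qProd q (Real.cos (2 * θ)) q *
      (qHermiteGen q θ (a * q) * qHermiteGen q θ (b * q)) *
      (Real.sin θ ^ 2 /
        ((1 - 2 * Real.cos θ * a + a ^ 2) * (1 - 2 * Real.cos θ * b + b ^ 2))) := by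
  rw [ascWeight, hermiteWeight_eq hq, inv_qProd_eq_div hq θ ha, inv_qProd_eq_div hq θ hb]
  simp only [div_eq_mul_inv, mul_inv]
  ring

theorem sin_sq_div_le {θ : ℝ} (hθ : θ ∈ Set.Ioo 0 Real.pi) (hab : |a * b| < 1) :
    Real.sin θ ^ 2 / ((1 - 2 * Real.cos θ * a + a ^ 2) * (1 - 2 * Real.cos θ * b + b ^ 2)) ≤
      ((1 - a * b) ^ 2)⁻¹ := by
  have hpos : 0 < (1 - a * b) ^ 2 := pow_pos (sub_pos.2 (abs_lt.1 hab).2) 2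
  rw [inv_eq_one_div, div_le_div_iff₀ (mul_pos (factor_pos hθ a) (factor_pos hθ b)) hpos,
    ← mul_pow, one_mul]
  exact sin_mul_one_sub_sq_le θ a b

theorem exists_ascWeight_bound (hq : |q| < 1) {r : ℝ} (hr : r < 1) :
    ∃ K, ∀ a b θ, |a| ≤ 1 → |b| ≤ 1 → |a * b| ≤ r → θ ∈ Set.Ioo 0 Real.pi →
      |ascWeight q a b θ| ≤ K := by
  obtain ⟨K, hK⟩ := exists_qHermiteGen_bound hq (r := |q|) (by rwa [abs_abs])
  refine ⟨4 * Real.exp (3 * (1 - |q|)⁻¹) * (K * K) * ((1 - r) ^ 2)⁻¹,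
    fun a b θ ha hb hab hθ => ?_⟩
  have hgen : ∀ {s}, |s| ≤ 1 → |qHermiteGen q θ (s * q)| ≤ K := fun hs =>
    hK θ _ (by simpa using abs_mul_pow_le (q := q) hs 1)
  have hK_nonneg : 0 ≤ K := (abs_nonneg _).trans (hgen ha)
  have hprod := qProd_le hq (Real.abs_cos_le_one (2 * θ)) hq.le
  have hprod_nonneg := qProd_nonneg hq (Real.abs_cos_le_one (2 * θ)) hq.le
  have hdenom := mul_pos (factor_pos hθ a) (factor_pos hθ b)
  have hsin := (sin_sq_div_le hθ (hab.trans_lt hr)).trans (inv_anti₀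
    (pow_pos (sub_pos.2 hr) 2) (pow_le_pow_left₀ (sub_pos.2 hr).le
      (sub_le_sub_left ((le_abs_self _).trans hab) 1) 2))
  rw [ascWeight_eq_div hq ha hb, abs_mul, abs_mul, abs_mul (qHermiteGen _ _ _),
    abs_of_nonneg (mul_nonneg zero_le_four hprod_nonneg),
    abs_of_nonneg (div_nonneg (sq_nonneg (Real.sin θ)) hdenom.le)]
  have hgen_a := hgen ha
  have hgen_b := hgen hb
  gcongr

theorem measurable_ascWeight (hq : |q| < 1) (ha : |a| ≤ 1) (hb : |b| ≤ 1) :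
    Measurable (ascWeight q a b) := by
  have hmeas : ∀ {s : ℝ}, |s| ≤ 1 → Measurable fun θ => (qProd q (Real.cos θ) s)⁻¹ := fun hs => by
    have hprod := measurable_qProd_cos hq hs 1
    simp only [one_mul] at hprod
    exact hprod.inv
  exact (measurable_hermiteWeight hq).mul ((hmeas ha).mul (hmeas hb))

theorem integrable_ascWeight_mul (hq : |q| < 1) (ha : |a| ≤ 1) (hb : |b| ≤ 1)
    (hab : |a * b| < 1) {f : ℝ → ℝ} (hf : Continuous f) :
    Integrable (fun θ => ascWeight q a b θ * f θ) arc := by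
  obtain ⟨K, hK⟩ := exists_ascWeight_bound hq hab
  exact (integrable_arc_of_continuous hf).bdd_mul
    (measurable_ascWeight hq ha hb).aestronglyMeasurable
    (ae_arc_of_forall fun θ hθ => hK a b θ ha hb le_rfl hθ)

theorem integral_ascWeight_of_lt (hq : |q| < 1) (ha : |a| < 1) (hb : |b| < 1) :
    ∫ θ, ascWeight q a b θ ∂arc = 2 * Real.pi / qPochInf q q * eulerSeries q (a * b) := by
  simp only [ascWeight, inv_qProd_eq_qHermiteGen hq _ ha, inv_qProd_eq_qHermiteGen hq _ hb]
  exact integral_qHermiteGen_mul_qHermiteGen hq ha hb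

theorem continuousOn_inv_qProd (hq : |q| < 1) {θ : ℝ} (hθ : θ ∈ Set.Ioo 0 Real.pi) :
    ContinuousOn (fun s => (qProd q (Real.cos θ) s)⁻¹) {s | |s| ≤ 1} := by
  have hgen : ContinuousOn (fun s => qHermiteGen q θ (s * q)) {s | |s| ≤ 1} := fun s hs =>
    (ContinuousAt.comp (f := (· * q)) (continuousAt_qHermiteGen hq θ (abs_mul_lt_one hq hs))
      (continuous_mul_const q).continuousAt).continuousWithinAt
  exact (hgen.div (by fun_prop) fun s _ => (factor_pos hθ s).ne').congr fun s hs =>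
    inv_qProd_eq_div hq θ hs

theorem abs_mul_le_of_mem_Ioo {t s : ℝ} (ht : t ∈ Set.Ioo (0 : ℝ) 1) : |t * s| ≤ |s| := by
  rw [abs_mul, abs_of_pos ht.1]
  exact mul_le_of_le_one_left (abs_nonneg s) ht.2.le

theorem tendsto_integral_ascWeight (hq : |q| < 1) (ha : |a| ≤ 1) (hb : |b| ≤ 1)
    (hab : |a * b| < 1) :
    Tendsto (fun t => ∫ θ, ascWeight q (t * a) (t * b) θ ∂arc) (𝓝[<] 1)
      (𝓝 (∫ θ, ascWeight q a b θ ∂arc)) := by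
  obtain ⟨K, hK⟩ := exists_ascWeight_bound hq hab
  have hIoo := Ioo_mem_nhdsLT (zero_lt_one (α := ℝ))
  have hscale : ∀ {s : ℝ}, |s| ≤ 1 →
      Tendsto (fun t => t * s) (𝓝[<] 1) (𝓝[{s | |s| ≤ 1}] s) := fun {s} hs => by
    refine tendsto_nhdsWithin_iff.2 ⟨?_, mem_of_superset hIoo fun t ht =>
      (abs_mul_le_of_mem_Ioo ht).trans hs⟩
    have hlim : Tendsto (fun t : ℝ => t * s) (𝓝 1) (𝓝 (1 * s)) := tendsto_id.mul_const s
    exact (one_mul s ▸ hlim).mono_left nhdsWithin_le_nhds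
  refine tendsto_integral_filter_of_dominated_convergence (fun _ => K) ?_ ?_
    (integrable_const K) (ae_arc_of_forall fun θ hθ => ?_)
  · filter_upwards [hIoo] with t ht
    exact (measurable_ascWeight hq ((abs_mul_le_of_mem_Ioo ht).trans ha)
      ((abs_mul_le_of_mem_Ioo ht).trans hb)).aestronglyMeasurable
  · filter_upwards [hIoo] with t ht
    refine ae_arc_of_forall fun θ hθ => hK _ _ θ ((abs_mul_le_of_mem_Ioo ht).trans ha)
      ((abs_mul_le_of_mem_Ioo ht).trans hb) ?_ hθ
    rw [abs_mul, abs_mul a]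
    exact mul_le_mul (abs_mul_le_of_mem_Ioo ht) (abs_mul_le_of_mem_Ioo ht) (abs_nonneg _)
      (abs_nonneg _)
  · exact (((continuousOn_inv_qProd hq hθ a ha).tendsto.comp (hscale ha)).mul
      ((continuousOn_inv_qProd hq hθ b hb).tendsto.comp (hscale hb))).const_mul _

theorem integral_ascWeight (hq : |q| < 1) (ha : |a| ≤ 1) (hb : |b| ≤ 1) (hab : |a * b| < 1) :
    ∫ θ, ascWeight q a b θ ∂arc = 2 * Real.pi / qPochInf q q * eulerSeries q (a * b) := by
  have hcont : ContinuousAt (fun t : ℝ => eulerSeries q (t * a * (t * b))) 1 := by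
    refine ContinuousAt.comp (g := eulerSeries q) ?_ (by fun_prop)
    simpa only [one_mul] using continuousAt_eulerSeries hq hab
  have hseries : Tendsto (fun t : ℝ => eulerSeries q (t * a * (t * b))) (𝓝[<] 1)
      (𝓝 (eulerSeries q (a * b))) := by
    simpa only [one_mul] using hcont.tendsto.mono_left nhdsWithin_le_nhds
  refine tendsto_nhds_unique (tendsto_integral_ascWeight hq ha hb hab)
    ((hseries.const_mul _).congr' ?_)
  filter_upwards [Ioo_mem_nhdsLT (zero_lt_one (α := ℝ))] with t ht
  have ht_abs : |t| < 1 := abs_lt.2 ⟨by linarith [ht.1], ht.2⟩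
  refine (integral_ascWeight_of_lt hq ?_ ?_).symm <;> rw [mul_comm]
  exacts [abs_mul_lt_one ht_abs ha, abs_mul_lt_one ht_abs hb]

end AlSalamChiharaWeight

section AlSalamChiharaPolynomials

/-- The Al-Salam–Chihara polynomials `Q_k(c; a, b | q)`. -/
def ascPoly (q a b c : ℝ) : ℕ → ℝ
  | 0 => 1
  | 1 => 2 * c - (a + b)
  | k + 2 => (2 * c - (a + b) * q ^ (k + 1)) * ascPoly q a b c (k + 1) -
      (1 - q ^ (k + 1)) * (1 - a * b * q ^ k) * ascPoly q a b c k

theorem ascPoly_zero (q a b c : ℝ) : ascPoly q a b c 0 = 1 := rfl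

theorem ascPoly_one (q a b c : ℝ) : ascPoly q a b c 1 = 2 * c - (a + b) := rfl

theorem ascPoly_succ_succ (q a b c : ℝ) (k : ℕ) : ascPoly q a b c (k + 2) =
    (2 * c - (a + b) * q ^ (k + 1)) * ascPoly q a b c (k + 1) -
      (1 - q ^ (k + 1)) * (1 - a * b * q ^ k) * ascPoly q a b c k := rfl

theorem ascPoly_comm (q a b c : ℝ) (k : ℕ) : ascPoly q a b c k = ascPoly q b a c k := by
  induction k using Nat.twoStepInduction with
  | zero => rfl
  | one => rw [ascPoly_one, ascPoly_one, add_comm]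
  | more k ih ih_succ =>
    rw [ascPoly_succ_succ, ascPoly_succ_succ, ih, ih_succ, add_comm a, mul_comm a]

theorem factor_mul_ascPoly (q a b c : ℝ) (k : ℕ) :
    (1 - 2 * c * a + a ^ 2) * ascPoly q (a * q) b c k =
      -(a * ascPoly q a b c (k + 1)) + (1 - a * b * q ^ k) * ascPoly q a b c k := by
  induction k using Nat.twoStepInduction with
  | zero => rw [ascPoly_zero, ascPoly_zero, zero_add, ascPoly_one]; ring
  | one =>
    rw [ascPoly_one, ascPoly_one, ascPoly_succ_succ, zero_add, ascPoly_one, ascPoly_zero]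
    ring
  | more k ih ih_succ =>
    have hrec := ascPoly_succ_succ q a b c k
    rw [ascPoly_succ_succ q (a * q), ascPoly_succ_succ q a b c (k + 1)]
    rw [hrec] at ih_succ ⊢
    linear_combination (2 * c - (a * q + b) * q ^ (k + 1)) * ih_succ -
      (1 - q ^ (k + 1)) * (1 - a * q * b * q ^ k) * ih

theorem ascPoly_zero_zero {q : ℝ} (hq : |q| < 1) (θ : ℝ) (k : ℕ) :
    ascPoly q 0 0 (Real.cos θ) k = qFact q k * qHermite q θ k := by
  induction k using Nat.twoStepInduction with
  | zero => rw [ascPoly_zero, qFact_zero, qHermite_zero, one_mul]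
  | one =>
    have hrec := two_cos_mul_qHermite hq θ 0
    rw [qHermitePred, qHermite_zero] at hrec
    rw [ascPoly_one, qFact_succ, qFact_zero]
    linear_combination hrec
  | more k ih ih_succ =>
    have hrec := two_cos_mul_qHermite hq θ (k + 1)
    rw [qHermitePred] at hrec
    rw [ascPoly_succ_succ, ih, ih_succ, qFact_succ q (k + 1), qFact_succ q k]
    linear_combination (qFact q k * (1 - q ^ (k + 1))) * hrec

theorem continuous_ascPoly (q a b : ℝ) (k : ℕ) :
    Continuous fun θ => ascPoly q a b (Real.cos θ) k := by
  induction k using Nat.twoStepInduction with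
  | zero => simp only [ascPoly_zero]; fun_prop
  | one => simp only [ascPoly_one]; fun_prop
  | more k ih ih_succ => simp only [ascPoly_succ_succ]; fun_prop

end AlSalamChiharaPolynomials

section AlSalamChiharaMoments

/-- The integral of the `k`-th Al-Salam–Chihara polynomial against its weight. -/
noncomputable def ascMoment (q a b : ℝ) (k : ℕ) : ℝ :=
  ∫ θ, ascWeight q a b θ * ascPoly q a b (Real.cos θ) k ∂arc

theorem ascMoment_comm (q a b : ℝ) (k : ℕ) : ascMoment q a b k = ascMoment q b a k := by
  simp only [ascMoment, ascWeight_comm q a b, ascPoly_comm q a b]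

variable {q a b : ℝ}

theorem ascWeight_mul_left (hq : |q| < 1) (ha : |a| ≤ 1) {θ : ℝ} (hθ : θ ∈ Set.Ioo 0 Real.pi) :
    ascWeight q (a * q) b θ = (1 - 2 * Real.cos θ * a + a ^ 2) * ascWeight q a b θ := by
  rw [ascWeight, ascWeight, qProd_eq_mul hq (Real.abs_cos_le_one θ) ha, mul_inv,
    mul_left_comm (1 - 2 * Real.cos θ * a + a ^ 2), mul_assoc (_)⁻¹,
    mul_inv_cancel_left₀ (factor_pos hθ a).ne']

theorem ascMoment_mul_left (hq : |q| < 1) (ha : |a| ≤ 1) (hb : |b| ≤ 1) (hab : |a * b| < 1)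
    (k : ℕ) :
    ascMoment q (a * q) b k =
      -(a * ascMoment q a b (k + 1)) + (1 - a * b * q ^ k) * ascMoment q a b k := by
  have hint := fun k => integrable_ascWeight_mul hq ha hb hab (continuous_ascPoly q a b k)
  rw [ascMoment, ascMoment, ascMoment, ← integral_const_mul, ← integral_const_mul,
    ← integral_neg, ← integral_add ((hint _).const_mul _).fun_neg ((hint _).const_mul _)]
  refine integral_congr_ae (ae_arc_of_forall fun θ hθ => ?_)
  beta_reduce
  rw [ascWeight_mul_left hq ha hθ]
  linear_combination ascWeight q a b θ * factor_mul_ascPoly q a b (Real.cos θ) k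

theorem ascMoment_zero (hq : |q| < 1) (ha : |a| ≤ 1) (hb : |b| ≤ 1) (hab : |a * b| < 1) :
    ascMoment q a b 0 = 2 * Real.pi / qPochInf q q * eulerSeries q (a * b) := by
  simp only [ascMoment, ascPoly_zero, mul_one, integral_ascWeight hq ha hb hab]

theorem ascMoment_mul_left_zero (hq : |q| < 1) (ha : |a| ≤ 1) (hb : |b| ≤ 1)
    (hab : |a * b| < 1) : ascMoment q (a * q) b 0 = (1 - a * b) * ascMoment q a b 0 := by
  have hab_q : |a * q * b| < 1 := by
    rw [mul_right_comm]
    exact abs_mul_lt_one hq hab.le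
  rw [ascMoment_zero hq ha hb hab, ascMoment_zero hq (abs_mul_lt_one hq ha).le hb hab_q,
    mul_left_comm, one_sub_mul_eulerSeries hq hab, mul_right_comm a]

theorem ascMoment_zero_zero_succ (hq : |q| < 1) (k : ℕ) : ascMoment q 0 0 (k + 1) = 0 := by
  have hweight : ∀ θ, ascWeight q 0 0 θ = hermiteWeight q θ := fun θ => by
    simp [ascWeight, qProd]
  simp only [ascMoment, hweight, ascPoly_zero_zero hq, mul_left_comm (hermiteWeight q _)]
  rw [integral_const_mul, integral_hermiteWeight_mul_qHermite hq k.succ_ne_zero, mul_zero]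

theorem ascMoment_succ_of_mul_left (hq : |q| < 1) (k : ℕ)
    (hk : ∀ {a b : ℝ}, |a| ≤ 1 → |b| ≤ 1 → |a * b| < 1 →
      ascMoment q (a * q) b k = (1 - a * b * q ^ k) * ascMoment q a b k)
    (ha : |a| ≤ 1) (hb : |b| ≤ 1) (hab : |a * b| < 1) : ascMoment q a b (k + 1) = 0 := by
  have hne : ∀ {a b : ℝ}, a ≠ 0 → |a| ≤ 1 → |b| ≤ 1 → |a * b| < 1 →
      ascMoment q a b (k + 1) = 0 := fun {a b} ha_ne ha hb hab => by
    have hmul : a * ascMoment q a b (k + 1) = 0 := by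
      linear_combination ascMoment_mul_left hq ha hb hab k - hk ha hb hab
    exact (mul_eq_zero.1 hmul).resolve_left ha_ne
  rcases eq_or_ne a 0 with rfl | ha_ne
  · rcases eq_or_ne b 0 with rfl | hb_ne
    · exact ascMoment_zero_zero_succ hq k
    · exact (ascMoment_comm q 0 b _).trans (hne hb_ne hb ha (by rwa [mul_comm]))
  · exact hne ha_ne ha hb hab

theorem ascMoment_succ (hq : |q| < 1) (ha : |a| ≤ 1) (hb : |b| ≤ 1) (hab : |a * b| < 1) (k : ℕ) :
    ascMoment q a b (k + 1) = 0 := by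
  induction k generalizing a b with
  | zero =>
    refine ascMoment_succ_of_mul_left hq 0 (fun ha hb hab => ?_) ha hb hab
    rw [pow_zero, mul_one, ascMoment_mul_left_zero hq ha hb hab]
  | succ k ih =>
    refine ascMoment_succ_of_mul_left hq (k + 1) (fun {a b} ha hb hab => ?_) ha hb hab
    rw [ih ha hb hab, ih (abs_mul_lt_one hq ha).le hb, mul_zero]
    rw [mul_right_comm]
    exact abs_mul_lt_one hq hab.le

end AlSalamChiharaMoments

/-! ### The explicit moment functional -/

section Moment

variable {y q θ : ℝ}

theorem abs_inv_sqrt_le_one (hy : 1 ≤ y) : |(√y)⁻¹| ≤ 1 := by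
  rw [abs_inv, abs_of_nonneg (Real.sqrt_nonneg y)]
  exact inv_le_one_of_one_le₀ (Real.one_le_sqrt.2 hy)

theorem abs_mul_sqrt_le_one (hy : 0 ≤ y) (hyq : y * q ^ 2 ≤ 1) : |q * √y| ≤ 1 := by
  rwa [← sq_le_one_iff_abs_le_one, mul_pow, Real.sq_sqrt hy, mul_comm]

theorem inv_sqrt_mul_mul_sqrt (hy : 0 < y) (q : ℝ) : (√y)⁻¹ * (q * √y) = q := by
  rw [mul_comm q, inv_mul_cancel_left₀ (Real.sqrt_pos.2 hy).ne']

/-- The parametrization of the support by an angle, inverse to `arccos ∘ v₂`. -/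
noncomputable def supportMap (y q θ : ℝ) : ℝ := (y + 1 - 2 * √y * Real.cos θ) / (1 - q)

theorem v₂_supportMap (hq : q < 1) (hy : 0 < y) (θ : ℝ) :
    v₂ y q (supportMap y q θ) = Real.cos θ := by
  have hq_ne : 1 - q ≠ 0 := (sub_pos.2 hq).ne'
  have hy_ne : √y ≠ 0 := (Real.sqrt_pos.2 hy).ne'
  rw [v₂, supportMap]
  field_simp
  ring

theorem u₂_supportMap (hq : q < 1) (hy : 0 < y) (θ : ℝ) :
    u₂ y q (supportMap y q θ) = Real.cos (2 * θ) := by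
  have hq_ne : 1 - q ≠ 0 := (sub_pos.2 hq).ne'
  rw [u₂, supportMap, Real.cos_two_mul]
  field_simp
  linear_combination 4 * Real.cos θ ^ 2 * Real.sq_sqrt hy.le

theorem supportMap_arccos_v₂ (hq : q < 1) (hy : 0 < y) {x : ℝ}
    (hx : v₂ y q x ∈ Set.Ioo (-1) 1) : supportMap y q (Real.arccos (v₂ y q x)) = x := by
  have hq_ne : 1 - q ≠ 0 := (sub_pos.2 hq).ne'
  have hy_ne : √y ≠ 0 := (Real.sqrt_pos.2 hy).ne'
  rw [supportMap, Real.cos_arccos hx.1.le hx.2.le, v₂]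
  field_simp
  ring

theorem v₂_mem_Ioo_iff (hq : q < 1) (hy : 0 < y) {x : ℝ} :
    v₂ y q x ∈ Set.Ioo (-1) 1 ↔ x ∈ Set.Ioo (Bminus y q) (Bplus y q) := by
  have hq_pos : 0 < 1 - q := sub_pos.2 hq
  have hy_pos : 0 < 2 * √y := mul_pos two_pos (Real.sqrt_pos.2 hy)
  have hsq := Real.sq_sqrt hy.le
  rw [v₂, div_mul_eq_mul_div, ← add_div, Set.mem_Ioo, Set.mem_Ioo, Bminus, Bplus,
    lt_div_iff₀ hy_pos, div_lt_one hy_pos, div_lt_iff₀ hq_pos, lt_div_iff₀ hq_pos, and_comm]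
  constructor <;> rintro ⟨hlower, hupper⟩ <;> constructor <;> linarith

theorem image_supportMap (hq : q < 1) (hy : 0 < y) :
    supportMap y q '' Set.Ioo 0 Real.pi = Set.Ioo (Bminus y q) (Bplus y q) := by
  ext x
  rw [← v₂_mem_Ioo_iff hq hy]
  refine ⟨?_, fun hx => ⟨Real.arccos (v₂ y q x),
    ⟨Real.arccos_pos.2 hx.2, Real.arccos_lt_pi.2 hx.1⟩, supportMap_arccos_v₂ hq hy hx⟩⟩
  rintro ⟨θ, hθ, rfl⟩
  rw [v₂_supportMap hq hy]
  exact Real.mapsTo_cos_Ioo hθ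

theorem injOn_supportMap (hq : q < 1) (hy : 0 < y) :
    Set.InjOn (supportMap y q) (Set.Ioo 0 Real.pi) := by
  intro θ hθ φ hφ h
  have hcos := congrArg (v₂ y q) h
  rw [v₂_supportMap hq hy, v₂_supportMap hq hy] at hcos
  exact Real.injOn_cos (Set.Ioo_subset_Icc_self hθ) (Set.Ioo_subset_Icc_self hφ) hcos

theorem hasDerivAt_supportMap (y q θ : ℝ) :
    HasDerivAt (supportMap y q) (2 * √y * Real.sin θ / (1 - q)) θ := by
  have hderiv := (((Real.hasDerivAt_cos θ).const_mul (2 * √y)).const_sub (y + 1)).div_const (1 - q)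
  exact hderiv.congr_deriv (by ring)

theorem continuous_supportMap (y q : ℝ) : Continuous (supportMap y q) := by
  unfold supportMap
  fun_prop

theorem qProd_ne_zero (hq : |q| < 1) {s : ℝ} (hs : |s| ≤ 1) (hθ : θ ∈ Set.Ioo 0 Real.pi) :
    qProd q (Real.cos θ) s ≠ 0 := by
  rw [qProd_eq_mul hq (Real.abs_cos_le_one θ) hs]
  exact mul_ne_zero (factor_pos hθ s).ne'
    (left_ne_zero_of_mul_eq_one (qProd_mul_qHermiteGen hq θ (abs_mul_lt_one hq hs)))

theorem hasProd_weight_supportMap (hq : |q| < 1) (hy : 1 ≤ y) (hyq : y * q ^ 2 ≤ 1)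
    (hθ : θ ∈ Set.Ioo 0 Real.pi) :
    HasProd (fun k : ℕ => (1 - 2 * Real.cos (2 * θ) * q ^ k + q ^ (2 * k)) /
      ((1 - 2 * Real.cos θ * q ^ k / √y + q ^ (2 * k) / y) *
        (1 - 2 * Real.cos θ * q ^ (k + 1) * √y + q ^ (2 * k + 2) * y)))
      (ascWeight q (√y)⁻¹ (q * √y) θ) := by
  have ha := abs_inv_sqrt_le_one hy
  have hb := abs_mul_sqrt_le_one (zero_le_one.trans hy) hyq
  have hcos := Real.abs_cos_le_one θ
  have hsq := Real.sq_sqrt (zero_le_one.trans hy)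
  have hprod := (hasProd_qProd hq (Real.abs_cos_le_one (2 * θ)) abs_one.le).div₀
    ((hasProd_qProd hq hcos ha).mul (hasProd_qProd hq hcos hb))
    (mul_ne_zero (qProd_ne_zero hq ha hθ) (qProd_ne_zero hq hb hθ))
  rw [div_eq_mul_inv, mul_inv] at hprod
  refine hprod.congr_fun fun k => ?_
  have ha_sq : ((√y)⁻¹ * q ^ k) ^ 2 = q ^ (2 * k) / y := by
    rw [mul_pow, inv_pow, hsq]
    ring
  have hb_sq : (q * √y * q ^ k) ^ 2 = q ^ (2 * k + 2) * y := by
    rw [mul_pow, mul_pow, hsq]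
    ring
  rw [ha_sq, hb_sq]
  congr 1 <;> ring

theorem weight_supportMap (hq : |q| < 1) (hy : 1 ≤ y) (hyq : y * q ^ 2 ≤ 1)
    (hθ : θ ∈ Set.Ioo 0 Real.pi) :
    weight y q (supportMap y q θ) = ascWeight q (√y)⁻¹ (q * √y) θ / Real.sin θ := by
  have hq_lt := lt_of_abs_lt hq
  have hy_pos := zero_lt_one.trans_le hy
  rw [weight, v₂_supportMap hq_lt hy_pos, u₂_supportMap hq_lt hy_pos, ← Real.sin_sq,
    Real.sqrt_sq (Real.sin_pos_of_mem_Ioo hθ).le, (hasProd_weight_supportMap hq hy hyq hθ).tprod_eq]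

theorem abs_deriv_smul_weight (hq : |q| < 1) (hy : 1 ≤ y) (hyq : y * q ^ 2 ≤ 1) (f : ℝ[X])
    (hθ : θ ∈ Set.Ioo 0 Real.pi) :
    |2 * √y * Real.sin θ / (1 - q)| •
      (weight y q (supportMap y q θ) * f.eval (supportMap y q θ)) =
    2 * √y / (1 - q) * (ascWeight q (√y)⁻¹ (q * √y) θ * f.eval (supportMap y q θ)) := by
  have hq_pos : 0 < 1 - q := sub_pos.2 (lt_of_abs_lt hq)
  have hsin := Real.sin_pos_of_mem_Ioo hθ
  rw [weight_supportMap hq hy hyq hθ, abs_of_nonneg (by positivity), smul_eq_mul]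
  field_simp

theorem Bminus_le_Bplus (hq : q < 1) (y : ℝ) : Bminus y q ≤ Bplus y q := by
  refine div_le_div_of_nonneg_right ?_ (sub_pos.2 hq).le
  linarith [Real.sqrt_nonneg y]

theorem intervalIntegrable_weight_mul_eval (hq : |q| < 1) (hy : 1 ≤ y) (hyq : y * q ^ 2 ≤ 1)
    (f : ℝ[X]) :
    IntervalIntegrable (fun x => weight y q x * f.eval x) volume (Bminus y q) (Bplus y q) := by
  have hq_lt := lt_of_abs_lt hq
  have hy_pos := zero_lt_one.trans_le hy
  rw [intervalIntegrable_iff_integrableOn_Ioo_of_le (Bminus_le_Bplus hq_lt y),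
    ← image_supportMap hq_lt hy_pos,
    integrableOn_image_iff_integrableOn_abs_deriv_smul measurableSet_Ioo
      (fun θ _ => (hasDerivAt_supportMap y q θ).hasDerivWithinAt) (injOn_supportMap hq_lt hy_pos)]
  refine IntegrableOn.congr_fun ?_
    (fun θ hθ => (abs_deriv_smul_weight hq hy hyq f hθ).symm) measurableSet_Ioo
  exact (integrable_ascWeight_mul hq (abs_inv_sqrt_le_one hy) (abs_mul_sqrt_le_one hy_pos.le hyq)
    (by rwa [inv_sqrt_mul_mul_sqrt hy_pos])
    (f.continuous.comp (continuous_supportMap y q))).const_mul _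

theorem momentFunctional_eq (hq : |q| < 1) (hy : 1 ≤ y) (hyq : y * q ^ 2 ≤ 1) (f : ℝ[X]) :
    momentFunctional y q f = qPochInf q q * qPochInf q q / (2 * Real.pi) *
      ∫ θ, ascWeight q (√y)⁻¹ (q * √y) θ * f.eval (supportMap y q θ) ∂arc := by
  have hq_lt := lt_of_abs_lt hq
  have hy_pos := zero_lt_one.trans_le hy
  have hjacobian : (1 - q) / (2 * √y) * (2 * √y / (1 - q)) = 1 := by
    rw [div_mul_div_cancel₀ (mul_pos two_pos (Real.sqrt_pos.2 hy_pos)).ne',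
      div_self (sub_pos.2 hq_lt).ne']
  rw [momentFunctional, intervalIntegral.integral_of_le (Bminus_le_Bplus hq_lt y),
    integral_Ioc_eq_integral_Ioo, ← image_supportMap hq_lt hy_pos,
    integral_image_eq_integral_abs_deriv_smul measurableSet_Ioo
      (fun θ _ => (hasDerivAt_supportMap y q θ).hasDerivWithinAt) (injOn_supportMap hq_lt hy_pos),
    setIntegral_congr_fun measurableSet_Ioo
      (fun θ hθ => abs_deriv_smul_weight hq hy hyq f hθ), integral_const_mul, ← arc, mul_assoc,
    ← mul_assoc ((1 - q) / (2 * √y)), hjacobian, one_mul]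

theorem qInt_eq_div (hq : q ≠ 1) (k : ℕ) : qInt q k = (1 - q ^ k) / (1 - q) := by
  rw [qInt, geom_sum_eq hq, ← neg_div_neg_eq, neg_sub, neg_sub]

theorem eval_qLaguerre_supportMap (hq : q < 1) (hy : 0 < y) (θ : ℝ) (k : ℕ) :
    (qLaguerre y q k).eval (supportMap y q θ) =
      (-√y / (1 - q)) ^ k * ascPoly q (√y)⁻¹ (q * √y) (Real.cos θ) k := by
  have hq_ne : 1 - q ≠ 0 := (sub_pos.2 hq).ne'
  have hy_ne : √y ≠ 0 := (Real.sqrt_pos.2 hy).ne'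
  have hsq := Real.sq_sqrt hy.le
  induction k using Nat.twoStepInduction with
  | zero => rw [qLaguerre_zero, eval_one, pow_zero, ascPoly_zero, one_mul]
  | one =>
    rw [qLaguerre_one, eval_sub, eval_X, eval_C, supportMap, ascPoly_one]
    field_simp
    linear_combination -q * hsq
  | more k ih ih_succ =>
    rw [qLaguerre, eval_sub, eval_mul, eval_mul, ih, ih_succ, ascPoly_succ_succ,
      inv_sqrt_mul_mul_sqrt hy, qInt_eq_div hq.ne, qInt_eq_div hq.ne, eval_sub, eval_X, eval_C,
      eval_C, supportMap, pow_succ (-√y / (1 - q)) (k + 1),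
      pow_succ (-√y / (1 - q)) k]
    generalize (-√y / (1 - q)) ^ k = scale
    generalize ascPoly q (√y)⁻¹ (q * √y) (Real.cos θ) (k + 1) = Q_succ
    generalize ascPoly q (√y)⁻¹ (q * √y) (Real.cos θ) k = Q
    generalize √y = s at hy_ne hsq
    subst hsq
    field_simp
    ring

/-- The moment functional as a linear map, for parameters for which the integrals converge. -/
noncomputable def momentLinearMap (hq : |q| < 1) (hy : 1 ≤ y) (hyq : y * q ^ 2 ≤ 1) :
    ℝ[X] →ₗ[ℝ] ℝ where
  toFun := momentFunctional y q
  map_add' f g := by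
    have hint := intervalIntegrable_weight_mul_eval hq hy hyq
    simp only [momentFunctional, eval_add, mul_add]
    rw [intervalIntegral.integral_add (hint f) (hint g), mul_add]
  map_smul' c f := by
    simp only [momentFunctional, eval_smul, smul_eq_mul, RingHom.id_apply, mul_left_comm _ c]
    rw [intervalIntegral.integral_const_mul, mul_left_comm]

theorem momentFunctional_one (hq : |q| < 1) (hy : 1 ≤ y) (hyq : y * q ^ 2 ≤ 1) :
    momentFunctional y q 1 = 1 := by
  have hpoch := qPochInf_ne_zero hq
  have hpi := Real.pi_pos.ne'
  have hy_pos := zero_lt_one.trans_le hy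
  rw [momentFunctional_eq hq hy hyq]
  simp only [eval_one, mul_one]
  rw [integral_ascWeight hq (abs_inv_sqrt_le_one hy) (abs_mul_sqrt_le_one hy_pos.le hyq)
    (by rwa [inv_sqrt_mul_mul_sqrt hy_pos]), inv_sqrt_mul_mul_sqrt hy_pos, eulerSeries_self hq]
  field_simp

theorem momentFunctional_qLaguerre (hq : |q| < 1) (hy : 1 ≤ y) (hyq : y * q ^ 2 ≤ 1) {k : ℕ}
    (hk : k ≠ 0) : momentFunctional y q (qLaguerre y q k) = 0 := by
  obtain ⟨k, rfl⟩ := Nat.exists_eq_succ_of_ne_zero hk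
  have hy_pos := zero_lt_one.trans_le hy
  rw [momentFunctional_eq hq hy hyq]
  simp only [eval_qLaguerre_supportMap (lt_of_abs_lt hq) hy_pos,
    mul_left_comm (ascWeight q _ _ _)]
  rw [integral_const_mul, ← ascMoment, ascMoment_succ hq (abs_inv_sqrt_le_one hy)
    (abs_mul_sqrt_le_one hy_pos.le hyq) (by rwa [inv_sqrt_mul_mul_sqrt hy_pos]), mul_zero,
    mul_zero]

end Moment

end QLaguerre

theorem mainTheorem4 {m : ℕ} (n : Fin m → ℕ) :
    (∀ y q : ℝ, -1 < q → q < 1 → 1 ≤ y → y * q ^ 2 ≤ 1 →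
      IntervalIntegrable
          (fun x => QLaguerre.weight y q x * (∏ j, QLaguerre.qLaguerre y q (n j)).eval x)
          MeasureTheory.volume (QLaguerre.Bminus y q) (QLaguerre.Bplus y q) ∧
        QLaguerre.derangementSum y q n =
          QLaguerre.momentFunctional y q (∏ j, QLaguerre.qLaguerre y q (n j))) ∧
    (∀ (R : Type*) [CommRing R] (y q : R) (Λ : Polynomial R →ₗ[R] R),
      QLaguerre.IsOrthogonalityFunctional y q Λ →
        QLaguerre.derangementSum y q n = Λ (∏ j, QLaguerre.qLaguerre y q (n j))) := by
  refine ⟨fun y q hq_neg hq_lt hy hyq => ?_, fun R _ y q Λ hΛ =>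
    QLaguerre.derangementSum_eq_of_isOrthogonalityFunctional y q n Λ hΛ⟩
  have hq : |q| < 1 := abs_lt.2 ⟨hq_neg, hq_lt⟩
  exact ⟨QLaguerre.intervalIntegrable_weight_mul_eval hq hy hyq _,
    QLaguerre.derangementSum_eq_of_vanishing y q n (QLaguerre.momentLinearMap hq hy hyq)
      (QLaguerre.momentFunctional_one hq hy hyq)
      fun _ hk => QLaguerre.momentFunctional_qLaguerre hq hy hyq hk⟩
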